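/- **Setting.** A schema is a finite set of relation symbols, each with an arity in $\mathbb N$; a database over a schema with domain $D$ assigns to each symbol a relation over $D$ of its arity. A *dynamic program* $\mathcal P$ has an input schema $\tau_{\mathrm{in}}$, a disjoint auxiliary schema $\tau_{\mathrm{aux}}$, a designated query symbol $R_Q\in\tau_{\mathrm{aux}}$, for every $R\in\tau_{\mathrm{aux}}$ a first-order initialization formula over $\tau_{\mathrm{in}}$ with as many free variables as the arity of $R$, and, for every $R\in\tau_{\mathrm{aux}}$ and every operation $o\in\{\mathrm{ins}_S,\mathrm{del}_S : S\in\tau_{\mathrm{in}}\}$, a first-order update formula $\varphi^R_o(\vec x;\vec y)$ over $\tau_{\mathrm{in}}\cup\tau_{\mathrm{aux}}$ (with equality), where $\vec x$ and $\vec y$ have the arities of $S$ and $R$. On a finite non-empty domain $D$, the program starts with all input relations empty and with the auxiliary relations defined by the initialization formulas. A modification $(o,\vec a)$ with $o=\mathrm{ins}_S$ or $o=\mathrm{del}_S$ inserts the tuple $\vec a$ over $D$ into, or deletes it from, the input relation $S$, and simultaneously replaces each auxiliary relation $R$ by $\{\vec b : \varphi^R_o(\vec a;\vec b)\text{ holds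 in the state before the modification}\}$. The *emptiness problem* for a class $\mathcal C$ of dynamic programs asks, given $\mathcal P\in\mathcal C$, whether for every finite non-empty domain and every finite sequence of modifications the query relation $R_Q$ is empty in the resulting state. A *DynFO($\ell$-in, $m$-aux)-program* is a dynamic program all of whose input relations have arity at most $\ell$ and all of whose auxiliary relations have arity at most $m$. A *DynProp($\ell$-in, $m$-aux)-program* is such a program in which all update formulas are quantifier-free (initialization formulas may contain quantifiers). **Theorem.** The emptiness problem is undecidable for 1. DynFO($1$-in, $0$-aux)-programs, 2. DynProp($1$-in, $2$-aux)-programs, 3. DynProp($2$-in, $0$-aux)-programs. -/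

import Mathlib

namespace DynComplexity

/-! ### Schemas, databases, modifications -/

/-- A finite relational schema: finitely many relation symbols, each with an arity. -/
structure Schema where
  size : ℕ
  arity : Fin size → ℕ

/-- The relational first-order language of a schema (equality is built into Mathlib's formulas). -/
def Schema.lang (σ : Schema) : FirstOrder.Language.{0, 0} where
  Functions := fun _ => Empty
  Relations := fun n => {R : Fin σ.size // σ.arity R = n}

instance (σ : Schema) : σ.lang.IsRelational := fun _ => ⟨fun f => Empty.elim f⟩

/-- A database with schema `σ` and domain `D`. -/
def Database (σ : Schema) (D : Type) : Type :=
  (R : Fin σ.size) → Set (Fin (σ.arity R) → D)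

/-- The empty database: all its relations are empty (its domain need not be). -/
def Database.empty (σ : Schema) (D : Type) : Database σ D := fun _ => ∅

/-- The first-order structure with domain `D` given by a database. -/
@[reducible] def Database.toStructure {σ : Schema} {D : Type} (I : Database σ D) :
    σ.lang.Structure D where
  funMap := fun f _ => Empty.elim f
  RelMap := fun R a => (fun i => a (Fin.cast R.2 i)) ∈ I R.1

/-- The two kinds of operations on a relation. -/
inductive OpKind : Type
  | ins
  | del

/-- A modification `(o, a)`: the operation `o` is `ins_S` or `del_S` for a symbol `S` of the
schema, and `a` is a tuple over the domain of the same arity as `S`. -/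
structure Modification (σ : Schema) (D : Type) where
  kind : OpKind
  symbol : Fin σ.size
  tuple : Fin (σ.arity symbol) → D

/-- The database that results from a modification. -/
def Modification.apply {σ : Schema} {D : Type} (δ : Modification σ D) (I : Database σ D) :
    Database σ D :=
  match δ.kind with
  | .ins => Function.update I δ.symbol (I δ.symbol ∪ {δ.tuple})
  | .del => Function.update I δ.symbol (I δ.symbol \ {δ.tuple})

/-! ### Dynamic programs -/

/-- The language of the combined schema `σin ∪ σaux` (disjoint union). -/
abbrev combinedLang (σin σaux : Schema) : FirstOrder.Language.{0, 0} := σin.lang.sum σaux.lang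

/-- A dynamic program with first-order update formulas and first-order initialization.
For an operation on the input symbol `S` and an auxiliary symbol `R`, the update formula
`φ(x; y)` is over the combined schema; its free variables are `x` (`Sum.inl`, as many as the
arity of `S`) and `y` (`Sum.inr`, as many as the arity of `R`). -/
structure DynProgram where
  inSchema : Schema
  auxSchema : Schema
  update : (k : OpKind) → (S : Fin inSchema.size) → (R : Fin auxSchema.size) →
    (combinedLang inSchema auxSchema).Formula
      (Fin (inSchema.arity S) ⊕ Fin (auxSchema.arity R))
  init : (R : Fin auxSchema.size) → inSchema.lang.Formula (Fin (auxSchema.arity R))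
  query : Fin auxSchema.size

/-- A program state over the domain `D`: an input database and an auxiliary database. -/
structure State (P : DynProgram) (D : Type) where
  input : Database P.inSchema D
  aux : Database P.auxSchema D

/-- The first-order structure over the combined schema given by a program state. -/
@[reducible] def State.toStructure {P : DynProgram} {D : Type} (s : State P D) :
    (combinedLang P.inSchema P.auxSchema).Structure D :=
  letI := s.input.toStructure
  letI := s.aux.toStructure
  inferInstance

namespace DynProgram

/-- The initial state for an input database `I`. -/
def initState (P : DynProgram) {D : Type} (I : Database P.inSchema D) : State P D where
  input := I
  aux := fun R => {b | letI := I.toStructure; (P.init R).Realize b}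

/-- The effect of a single modification on a state. All update formulas are evaluated in the
state before the modification. -/
def step (P : DynProgram) {D : Type} (s : State P D) (δ : Modification P.inSchema D) :
    State P D where
  input := δ.apply s.input
  aux := fun R =>
    {b | letI := s.toStructure; (P.update δ.kind δ.symbol R).Realize (Sum.elim δ.tuple b)}

/-- The state reached from the initial state for `I` by a sequence of modifications (the head of
the list is applied first). -/
def run (P : DynProgram) {D : Type} (I : Database P.inSchema D)
    (α : List (Modification P.inSchema D)) : State P D :=
  α.foldl P.step (P.initState I)

/-- The emptiness property: over every finite non-empty domain, starting from the empty input
database, every modification sequence leads to a state with empty query relation. -/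
def QueryAlwaysEmpty (P : DynProgram) : Prop :=
  ∀ (D : Type) [Finite D] [Nonempty D] (α : List (Modification P.inSchema D)),
    (P.run (Database.empty P.inSchema D) α).aux P.query = ∅

end DynProgram

/-- `DynFO(l-in, m-aux)`-programs: input relations of arity at most `l`, auxiliary relations of
arity at most `m`. -/
def DynFO (l m : ℕ) : Set DynProgram :=
  {P | (∀ S, P.inSchema.arity S ≤ l) ∧ (∀ R, P.auxSchema.arity R ≤ m)}

/-- `DynProp(l-in, m-aux)`-programs: in addition, all update formulas are quantifier-free
(initialization formulas may still use quantifiers). -/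
def DynProp (l m : ℕ) : Set DynProgram :=
  {P | P ∈ DynFO l m ∧ ∀ k S R, (P.update k S R).IsQF}

/-! ### Encoding of programs by natural numbers

Programs are the inputs of algorithms, so they are written as natural numbers by an explicit
injective Gödel numbering of their syntax. -/

/-- Code of a term of a relational language, that is, of a variable. -/
def termCode {L : FirstOrder.Language.{0, 0}} [L.IsRelational] {α : Type} [Encodable α] : L.Term α → ℕ
  | .var x => Encodable.encode x
  | .func f _ => isEmptyElim f

/-- Code of a formula, relative to a numbering `r` of the relation symbols. -/
def formulaCode {L : FirstOrder.Language.{0, 0}} [L.IsRelational] (r : ∀ n, L.Relations n → ℕ)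
    {α : Type} [Encodable α] : {n : ℕ} → L.BoundedFormula α n → ℕ
  | _, .falsum => 0
  | _, .equal t u => 4 * Nat.pair (termCode t) (termCode u) + 1
  | _, .rel (l := l) R ts =>
      4 * Nat.pair (r l R) (Encodable.encode (List.ofFn fun i => termCode (ts i))) + 2
  | _, .imp φ ψ => 4 * Nat.pair (formulaCode r φ) (formulaCode r ψ) + 3
  | _, .all φ => 4 * formulaCode r φ + 4

/-- Numbering of the relation symbols of a schema. -/
def symbolCode (σ : Schema) (n : ℕ) (R : σ.lang.Relations n) : ℕ := (R.1 : ℕ)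

/-- Numbering of the relation symbols of the combined schema. -/
def combinedSymbolCode (σin σaux : Schema) (n : ℕ) :
    (combinedLang σin σaux).Relations n → ℕ
  | .inl R => 2 * symbolCode σin n R
  | .inr R => 2 * symbolCode σaux n R + 1

/-- The arities of the symbols of a schema. -/
def Schema.arityList (σ : Schema) : List ℕ := List.ofFn σ.arity

/-- The Gödel number of a dynamic program: the two lists of arities, the query symbol, the list of
codes of initialization formulas, and for each input symbol and each auxiliary symbol the pair of
the codes of the update formulas for insertions and for deletions. -/
def DynProgram.code (P : DynProgram) : ℕ :=
  Encodable.encode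
    (P.inSchema.arityList, P.auxSchema.arityList, (P.query : ℕ),
      List.ofFn (fun R => formulaCode (symbolCode P.inSchema) (P.init R)),
      List.ofFn fun S => List.ofFn fun R =>
        (formulaCode (combinedSymbolCode P.inSchema P.auxSchema) (P.update .ins S R),
          formulaCode (combinedSymbolCode P.inSchema P.auxSchema) (P.update .del S R)))

theorem termCode_injective {L : FirstOrder.Language.{0, 0}} [L.IsRelational] {α : Type} [Encodable α] :
    Function.Injective (termCode : L.Term α → ℕ) := by
  intro t u h
  cases t with
  | func f _ => exact isEmptyElim f
  | var x =>
    cases u with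
    | func f _ => exact isEmptyElim f
    | var y => exact congrArg _ (Encodable.encode_injective h)

theorem cancel_four {a b c : ℕ} (h : 4 * a + c = 4 * b + c) : a = b := by omega

theorem formulaCode_injective {L : FirstOrder.Language.{0, 0}} [L.IsRelational]
    (r : ∀ n, L.Relations n → ℕ) (hr : ∀ n, Function.Injective (r n))
    {α : Type} [Encodable α] {n : ℕ} :
    Function.Injective (formulaCode r : L.BoundedFormula α n → ℕ) := by
  intro φ
  induction φ with
  | falsum => intro ψ h; cases ψ <;> simp only [formulaCode] at h <;> first | rfl | omega
  | equal t u =>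
    intro ψ h
    cases ψ <;> simp only [formulaCode] at h <;> try omega
    have h' := Nat.pair_eq_pair.1 (cancel_four h)
    rw [termCode_injective h'.1, termCode_injective h'.2]
  | @rel n l R ts =>
    intro ψ h
    cases ψ with
    | @rel _ l' R' ts' =>
      simp only [formulaCode] at h
      have h' := Nat.pair_eq_pair.1 (cancel_four h)
      have h2 := Encodable.encode_injective h'.2
      have hl : l = l' := by simpa using congrArg List.length h2
      subst hl
      have h3 := List.ofFn_injective h2
      have h4 : ts = ts' := funext fun i => termCode_injective (congrFun h3 i)
      rw [hr _ h'.1, h4]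
    | _ => simp only [formulaCode] at h; omega
  | imp φ₁ φ₂ ih₁ ih₂ =>
    intro ψ h
    cases ψ <;> simp only [formulaCode] at h <;> try omega
    have h' := Nat.pair_eq_pair.1 (cancel_four h)
    rw [ih₁ h'.1, ih₂ h'.2]
  | all φ ih =>
    intro ψ h
    cases ψ <;> simp only [formulaCode] at h <;> try omega
    rw [ih (cancel_four h)]

theorem symbolCode_injective (σ : Schema) (n : ℕ) : Function.Injective (symbolCode σ n) :=
  fun _ _ h => Subtype.ext (Fin.ext h)

theorem combinedSymbolCode_injective (σin σaux : Schema) (n : ℕ) :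
    Function.Injective (combinedSymbolCode σin σaux n) := by
  rintro (R | R) (R' | R') h <;> simp only [combinedSymbolCode] at h
  · exact congrArg _ (symbolCode_injective _ _ (by omega))
  · omega
  · omega
  · exact congrArg _ (symbolCode_injective _ _ (by omega))

theorem Schema.arityList_injective : Function.Injective Schema.arityList := by
  rintro ⟨n, a⟩ ⟨m, b⟩ h
  have hn : n = m := by simpa [Schema.arityList] using congrArg List.length h
  subst hn
  have hab : a = b := List.ofFn_injective h
  rw [hab]

/-- Different programs have different codes. -/
theorem DynProgram.code_injective : Function.Injective DynProgram.code := by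
  rintro ⟨σ, τ, u, i, q⟩ ⟨σ', τ', u', i', q'⟩ h
  have h := Encodable.encode_injective h
  simp only [Prod.mk.injEq] at h
  obtain ⟨h1, h2, h3, h4, h5⟩ := h
  cases Schema.arityList_injective h1
  cases Schema.arityList_injective h2
  cases Fin.ext h3
  have hi : i = i' := funext fun R =>
    formulaCode_injective _ (symbolCode_injective _) (congrFun (List.ofFn_injective h4) R)
  have hu : u = u' := by
    funext k S R
    have := congrFun (List.ofFn_injective (congrFun (List.ofFn_injective h5) S)) R
    simp only [Prod.mk.injEq] at this
    cases k
    · exact formulaCode_injective _ (combinedSymbolCode_injective _ _) this.1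
    · exact formulaCode_injective _ (combinedSymbolCode_injective _ _) this.2
  rw [hi, hu]

/-- The emptiness problem for the class `C` of programs is decidable: there is an algorithm that,
given (the code of) any program `P` in `C`, tells whether the query relation of `P` is always
empty. Nothing is required of the answers on numbers that are not codes of programs in `C`. -/
def EmptinessDecidable (C : Set DynProgram) : Prop :=
  ∃ f : ℕ → Bool, Computable f ∧ ∀ P ∈ C, (f P.code = true ↔ P.QueryAlwaysEmpty)

end DynComplexity

/-! The halting problem is reduced to emptiness, through counter programs. The instance `n` is
stored in the program itself: `n + 1` auxiliary symbols, each always full or empty, hold in unary a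
countdown that starts at `n` and can only decrease. All else in the program is fixed, so its Gödel
number is primitive recursive in `n` (`RawProgram.primrec_code`), and a decision procedure for
emptiness would decide a property of `n`.

A modification sequence plays the role of a nondeterministic run. A finite automaton reads
modifications as guarded actions; auxiliary bits hold the set of its reachable states, and this set
becomes empty as soon as no permitted action explains the modifications. The query relation is then
nonempty exactly if the modifications perform a word of a given regular language with all guards
satisfied (`Gadget.mem_query`). Control flow is thus a regular language, and only storage remains to
be built.

Regular expressions over increments, decrements and zero tests compute all partial recursive
functions (`implementable_of_partrec`): a star guesses the number of rounds of a loop, and a final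
zero test verifies the guess. Applied to the evaluation of the `n`-th code at `0`, this gives one
regular expression for which it is undecidable in `n` whether some word can be executed
(`exists_not_computablePred_runnable`).

A `Gadget.Simulation` realises the counters, in three ways. With quantifiers, a counter is the
cardinality of a unary input relation. With binary auxiliary relations, it is the height of a stack
of distinct elements; the links record what lies below each element, so that pushing and popping
need no quantifier. Without auxiliary storage of positive arity, the links are binary input
relations; each push or pop is a short word of modifications, in which the sequence guesses the
elements that a quantifier would have found and guards check the guess. Emptiness ranges over all
finite domains, so some domain has room for any given finite run. -/

namespace DynComplexity

open FirstOrder Language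

/-! ### Programs with uniform arities and a countdown -/

/-- Formulas over input symbols `S` of arity `p` and auxiliary symbols `B` of arity `r`, with a
test for an exhausted countdown. The variables are those of update formulas. -/
inductive Raw (p r : ℕ) (S B : Type) : Type
  | bot
  | eq (u v : Fin p ⊕ Fin r)
  | inp (s : S) (t : Fin p → Fin p ⊕ Fin r)
  | aux (b : B) (t : Fin r → Fin p ⊕ Fin r)
  | zero
  | diag (s : S)
  | imp (φ ψ : Raw p r S B)

namespace Raw

variable {p r : ℕ} {S B : Type}

/-- Truth of a formula; `c` is the value of the countdown. -/
def Eval {D : Type} (I : S → Set (Fin p → D)) (X : B → Set (Fin r → D)) (c : ℕ)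
    (ν : Fin p ⊕ Fin r → D) : Raw p r S B → Prop
  | bot => False
  | eq u v => ν u = ν v
  | inp s t => ν ∘ t ∈ I s
  | aux b t => ν ∘ t ∈ X b
  | zero => c = 0
  | diag s => ∃ x : D, (fun _ => x) ∈ I s
  | imp φ ψ => φ.Eval I X c ν → ψ.Eval I X c ν

/-- No quantifier occurs. -/
def QF : Raw p r S B → Prop
  | diag _ => False
  | imp φ ψ => φ.QF ∧ ψ.QF
  | _ => True

end Raw

/-- The schema with `k` symbols of arity `a`. -/
abbrev uniformSchema (k a : ℕ) : Schema := ⟨k, fun _ => a⟩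

namespace Raw

variable {p r : ℕ} {S B : Type}

/-- The first-order formula of a raw formula, given the places of the symbols in the schemas; the
countdown is exhausted if the auxiliary relation at place `z` is full. -/
def toFormula {a b : ℕ} (f : S → Fin a) (g : B → Fin b) (z : Fin b) :
    Raw p r S B →
      (combinedLang (uniformSchema a p) (uniformSchema b r)).Formula (Fin p ⊕ Fin r)
  | bot => .falsum
  | eq u v => .equal (.var (.inl u)) (.var (.inl v))
  | inp s t => .rel (l := p) (.inl ⟨f s, rfl⟩) fun i => .var (.inl (t i))
  | aux b t => .rel (l := r) (.inr ⟨g b, rfl⟩) fun i => .var (.inl (t i))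
  | zero => .rel (l := r) (.inr ⟨z, rfl⟩) fun i => .var (.inl (.inr i))
  | diag s => .imp (.all (.imp (.rel (l := p) (.inl ⟨f s, rfl⟩) fun _ => .var (.inr 0)) .falsum))
      .falsum
  | imp φ ψ => .imp (toFormula f g z φ) (toFormula f g z ψ)

theorem isQF_toFormula {a b : ℕ} (f : S → Fin a) (g : B → Fin b) (z : Fin b) :
    ∀ φ : Raw p r S B, φ.QF → (φ.toFormula f g z).IsQF
  | bot, _ => .falsum
  | eq _ _, _ => (BoundedFormula.IsAtomic.equal _ _).isQF
  | inp _ _, _ => (BoundedFormula.IsAtomic.rel _ _).isQF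
  | aux _ _, _ => (BoundedFormula.IsAtomic.rel _ _).isQF
  | zero, _ => (BoundedFormula.IsAtomic.rel _ _).isQF
  | diag _, h => h.elim
  | imp φ ψ, h => (isQF_toFormula f g z φ h.1).imp (isQF_toFormula f g z ψ h.2)

/-- The Gödel number of `toFormula`. -/
def code (f : S → ℕ) (g : B → ℕ) (z : ℕ) : Raw p r S B → ℕ
  | bot => 0
  | eq u v => 4 * Nat.pair (Encodable.encode (.inl u : (Fin p ⊕ Fin r) ⊕ Fin 0))
      (Encodable.encode (.inl v : (Fin p ⊕ Fin r) ⊕ Fin 0)) + 1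
  | inp s t => 4 * Nat.pair (2 * f s) (Encodable.encode
      (List.ofFn fun i => Encodable.encode (.inl (t i) : (Fin p ⊕ Fin r) ⊕ Fin 0))) + 2
  | aux b t => 4 * Nat.pair (2 * g b + 1) (Encodable.encode
      (List.ofFn fun i => Encodable.encode (.inl (t i) : (Fin p ⊕ Fin r) ⊕ Fin 0))) + 2
  | zero => 4 * Nat.pair (2 * z + 1) (Encodable.encode
      (List.ofFn fun i => Encodable.encode (.inl (.inr i) : (Fin p ⊕ Fin r) ⊕ Fin 0))) + 2
  | diag s => 4 * Nat.pair (4 * (4 * Nat.pair (4 * Nat.pair (2 * f s) (Encodable.encode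
      (List.ofFn fun _ : Fin p => Encodable.encode (.inr 0 : (Fin p ⊕ Fin r) ⊕ Fin 1))) + 2) 0 + 3)
        + 4) 0 + 3
  | imp φ ψ => 4 * Nat.pair (code f g z φ) (code f g z ψ) + 3

/-- Places enter the Gödel number only through their values as natural numbers. The schema may
therefore grow with the countdown while the codes of the formulas stay the same. -/
theorem formulaCode_toFormula {a b : ℕ} (f : S → Fin a) (g : B → Fin b) (z : Fin b) :
    ∀ φ : Raw p r S B, formulaCode (combinedSymbolCode _ _) (φ.toFormula f g z) =
      φ.code (fun s => f s) (fun b => g b) z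
  | bot => rfl
  | eq _ _ => rfl
  | inp _ _ => rfl
  | aux _ _ => rfl
  | zero => rfl
  | diag _ => rfl
  | imp φ ψ => by
    simp only [toFormula, formulaCode, code, formulaCode_toFormula f g z φ,
      formulaCode_toFormula f g z ψ]

theorem realize_toFormula {D : Type} {a b : ℕ} (f : S → Fin a) (g : B → Fin b) (z : Fin b)
    (I : Database (uniformSchema a p) D) (X : Database (uniformSchema b r) D)
    (I' : S → Set (Fin p → D)) (X' : B → Set (Fin r → D)) (c : ℕ)
    (hI : ∀ s, I (f s) = I' s) (hX : ∀ b, X (g b) = X' b)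
    (hz : X z = if c = 0 then Set.univ else ∅) (ν : Fin p ⊕ Fin r → D) :
    ∀ φ : Raw p r S B,
      (letI := I.toStructure; letI := X.toStructure; (φ.toFormula f g z).Realize ν) ↔
        φ.Eval I' X' c ν
  | bot => Iff.rfl
  | eq _ _ => Iff.rfl
  | inp s t => by rw [Eval, ← hI]; exact Iff.rfl
  | aux b t => by rw [Eval, ← hX]; exact Iff.rfl
  | zero => by
    -- The relation at `z` is full or empty, so any tuple tests it; the tuple of the `y`-variables
    -- has the right arity.
    have h : ν ∘ Sum.inr ∈ X z ↔ c = 0 := by rw [hz]; split_ifs with h <;> simp [h]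
    exact h
  | diag s => by
    have h : (¬ ∀ x : D, ¬ (fun _ => x) ∈ I (f s)) ↔ ∃ x : D, (fun _ => x) ∈ I' s := by
      rw [hI]; push Not; rfl
    exact h
  | imp φ ψ => by
    have h1 := realize_toFormula f g z I X I' X' c hI hX hz ν φ
    have h2 := realize_toFormula f g z I X I' X' c hI hX hz ν ψ
    exact imp_congr h1 h2

/-- Conjunction. -/
def and (φ ψ : Raw p r S B) : Raw p r S B := .imp (.imp φ (.imp ψ .bot)) .bot

/-- Negation. -/
def not (φ : Raw p r S B) : Raw p r S B := .imp φ .bot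

/-- Disjunction. -/
def or (φ ψ : Raw p r S B) : Raw p r S B := .imp (.imp φ .bot) ψ

/-- Disjunction of a family of formulas over a list. -/
def any {ι : Type} (φ : ι → Raw p r S B) : List ι → Raw p r S B
  | [] => .bot
  | i :: l => .or (φ i) (any φ l)

section
variable {D : Type} (I : S → Set (Fin p → D)) (X : B → Set (Fin r → D)) (c : ℕ)
  (ν : Fin p ⊕ Fin r → D)

@[simp] theorem eval_bot : (bot : Raw p r S B).Eval I X c ν ↔ False := Iff.rfl
@[simp] theorem eval_eq (u v) : (eq u v : Raw p r S B).Eval I X c ν ↔ ν u = ν v := Iff.rfl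
@[simp] theorem eval_inp (s t) : (inp s t : Raw p r S B).Eval I X c ν ↔ ν ∘ t ∈ I s := Iff.rfl
@[simp] theorem eval_aux (b t) : (aux b t : Raw p r S B).Eval I X c ν ↔ ν ∘ t ∈ X b := Iff.rfl
@[simp] theorem eval_zero : (zero : Raw p r S B).Eval I X c ν ↔ c = 0 := Iff.rfl
@[simp] theorem eval_diag (s) :
    (diag s : Raw p r S B).Eval I X c ν ↔ ∃ x : D, (fun _ => x) ∈ I s := Iff.rfl
@[simp] theorem eval_imp (φ ψ : Raw p r S B) :
    (imp φ ψ).Eval I X c ν ↔ (φ.Eval I X c ν → ψ.Eval I X c ν) := Iff.rfl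
@[simp] theorem eval_and (φ ψ : Raw p r S B) :
    (and φ ψ).Eval I X c ν ↔ φ.Eval I X c ν ∧ ψ.Eval I X c ν := by
  simp only [and, eval_imp, eval_bot]; tauto
@[simp] theorem eval_not (φ : Raw p r S B) : (not φ).Eval I X c ν ↔ ¬ φ.Eval I X c ν := Iff.rfl
@[simp] theorem eval_or (φ ψ : Raw p r S B) :
    (or φ ψ).Eval I X c ν ↔ φ.Eval I X c ν ∨ ψ.Eval I X c ν := by
  simp only [or, eval_imp, eval_bot]; tauto
@[simp] theorem eval_any {ι : Type} (φ : ι → Raw p r S B) (l : List ι) :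
    (any φ l).Eval I X c ν ↔ ∃ i ∈ l, (φ i).Eval I X c ν := by
  induction l with
  | nil => simp [any]
  | cons i l ih => simp [any, ih]
end

@[simp] theorem qf_bot : (bot : Raw p r S B).QF := trivial
@[simp] theorem qf_eq (u v) : (eq u v : Raw p r S B).QF := trivial
@[simp] theorem qf_inp (s t) : (inp s t : Raw p r S B).QF := trivial
@[simp] theorem qf_aux (b t) : (aux b t : Raw p r S B).QF := trivial
@[simp] theorem qf_zero : (zero : Raw p r S B).QF := trivial
@[simp] theorem qf_imp (φ ψ : Raw p r S B) : (imp φ ψ).QF ↔ φ.QF ∧ ψ.QF := Iff.rfl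
@[simp] theorem qf_and (φ ψ : Raw p r S B) : (and φ ψ).QF ↔ φ.QF ∧ ψ.QF := by simp [and]
@[simp] theorem qf_not (φ : Raw p r S B) : (not φ).QF ↔ φ.QF := by simp [not]
@[simp] theorem qf_or (φ ψ : Raw p r S B) : (or φ ψ).QF ↔ φ.QF ∧ ψ.QF := by simp [or]
theorem qf_any {ι : Type} (φ : ι → Raw p r S B) (l : List ι) (h : ∀ i ∈ l, (φ i).QF) :
    (any φ l).QF := by
  induction l with
  | nil => simp [any]
  | cons i l ih => simp_all [any]

end Raw

/-- A program with input symbols `S` of arity `p`, auxiliary symbols `B` of arity `r` and a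
countdown, which every deletion from `tick` decreases; the query symbol is chosen separately. -/
structure RawProgram (p r : ℕ) (S B : Type) where
  tick : S
  update : OpKind → S → B → Raw p r S B
  init : B → Bool

/-- A state of a raw program: the input, the auxiliary relations and the countdown. -/
structure RawState (p r : ℕ) (S B D : Type) where
  inp : S → Set (Fin p → D)
  aux : B → Set (Fin r → D)
  count : ℕ

/-- A modification of the input of a raw program. -/
structure RawMod (p : ℕ) (S D : Type) where
  kind : OpKind
  symbol : S
  tuple : Fin p → D

open Classical in
/-- The input after a modification. -/
noncomputable def RawMod.apply {p : ℕ} {S D : Type} (δ : RawMod p S D)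
    (I : S → Set (Fin p → D)) : S → Set (Fin p → D) :=
  match δ.kind with
  | .ins => Function.update I δ.symbol (I δ.symbol ∪ {δ.tuple})
  | .del => Function.update I δ.symbol (I δ.symbol \ {δ.tuple})

namespace RawProgram

variable {p r : ℕ} {S B : Type} (R : RawProgram p r S B) (q : B) {D : Type}

/-- The initial state, with countdown from `n`. -/
def start (n : ℕ) (D : Type) : RawState p r S B D where
  inp := fun _ => ∅
  aux := fun b => if R.init b then Set.univ else ∅
  count := n

open Classical in
/-- The effect of a modification. -/
noncomputable def step (s : RawState p r S B D) (δ : RawMod p S D) : RawState p r S B D where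
  inp := δ.apply s.inp
  aux := fun b => {y | (R.update δ.kind δ.symbol b).Eval s.inp s.aux s.count (Sum.elim δ.tuple y)}
  count := if δ.kind = .del ∧ δ.symbol = R.tick then s.count - 1 else s.count

/-- The state reached by a sequence of modifications. -/
noncomputable def run (s : RawState p r S B D) (α : List (RawMod p S D)) : RawState p r S B D :=
  α.foldl R.step s

variable [Fintype S] [Fintype B]

/-- The place of an input symbol. -/
noncomputable def inPlace (s : S) : Fin (Fintype.card S) := Fintype.equivFin S s

/-- The place of an auxiliary symbol. -/
noncomputable def auxPlace (n : ℕ) (b : B) : Fin (Fintype.card B + (n + 1)) :=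
  Fin.castAdd _ (Fintype.equivFin B b)

/-- The place of the auxiliary symbol that is full if the countdown is at most `j`. -/
def countPlace (B : Type) [Fintype B] (n j : ℕ) : Fin (Fintype.card B + (n + 1)) :=
  Fin.natAdd _ ⟨min j n, by omega⟩

/-- The update formula of the auxiliary symbol at place `i`. -/
noncomputable def updateAt (n : ℕ) (k : OpKind) (s : Fin (Fintype.card S))
    (i : Fin (Fintype.card B + (n + 1))) :
    (combinedLang (uniformSchema (Fintype.card S) p)
      (uniformSchema (Fintype.card B + (n + 1)) r)).Formula (Fin p ⊕ Fin r) :=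
  open Classical in
  if h : (i : ℕ) < Fintype.card B then
    (R.update k ((Fintype.equivFin S).symm s) ((Fintype.equivFin B).symm ⟨i, h⟩)).toFormula
      inPlace (auxPlace n) (countPlace B n 0)
  -- On a tick, the symbol for `count ≤ j` takes over the value of the symbol for `count ≤ j + 1`,
  -- which is the condition `count - 1 ≤ j`. All other operations copy it.
  else .rel (l := r)
    (.inr ⟨if k = .del ∧ (Fintype.equivFin S).symm s = R.tick then
        countPlace B n (i - Fintype.card B + 1) else i, rfl⟩)
    fun t => .var (.inl (.inr t))

/-- The initial truth value of the auxiliary symbol at place `i`. -/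
noncomputable def initAt (n : ℕ) (i : ℕ) : Bool :=
  if h : i < Fintype.card B then R.init ((Fintype.equivFin B).symm ⟨i, h⟩)
  else decide (n ≤ i - Fintype.card B)

/-- The dynamic program with countdown from `n` and query symbol `q`. -/
noncomputable def compile (q : B) (n : ℕ) : DynProgram where
  inSchema := uniformSchema (Fintype.card S) p
  auxSchema := uniformSchema (Fintype.card B + (n + 1)) r
  update := R.updateAt n
  init := fun i => if R.initAt n i then .imp .falsum .falsum else .falsum
  query := auxPlace n q

theorem compile_mem_dynFO (n : ℕ) : R.compile q n ∈ DynFO p r :=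
  ⟨fun _ => le_rfl, fun _ => le_rfl⟩

theorem compile_mem_dynProp (h : ∀ k s b, (R.update k s b).QF) (n : ℕ) :
    R.compile q n ∈ DynProp p r := by
  refine ⟨R.compile_mem_dynFO q n, fun k s i => ?_⟩
  change (R.updateAt n k s i).IsQF
  unfold updateAt
  split_ifs
  · exact Raw.isQF_toFormula _ _ _ _ (h _ _ _)
  · exact (BoundedFormula.IsAtomic.rel _ _).isQF
  · exact (BoundedFormula.IsAtomic.rel _ _).isQF

end RawProgram
end DynComplexity

/-! ### Correctness of compilation, and computability of the codes -/

namespace DynComplexity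

open FirstOrder Language

namespace RawProgram

variable {p r : ℕ} {S B : Type} (R : RawProgram p r S B) (q : B) {D : Type}
variable [Fintype S] [Fintype B]

/-- A state of the compiled program represents a state of the raw program. -/
structure Represents (n : ℕ) (s : State (R.compile q n) D) (a : RawState p r S B D) : Prop where
  inp : ∀ x, s.input (inPlace x) = a.inp x
  aux : ∀ b, s.aux (auxPlace n b) = a.aux b
  count : ∀ j ≤ n, s.aux (countPlace B n j) = if a.count ≤ j then Set.univ else ∅
  le : a.count ≤ n

/-- The modification of the compiled program that corresponds to one of the raw program. -/
noncomputable def compileMod (n : ℕ) (δ : RawMod p S D) : Modification (R.compile q n).inSchema D :=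
  ⟨δ.kind, inPlace δ.symbol, δ.tuple⟩

/-- Emptiness quantifies over all modification sequences of the compiled program, so none of them
may lie outside the raw model. -/
theorem compileMod_surjective (n : ℕ) :
    Function.Surjective (R.compileMod q n : RawMod p S D → _) := by
  rintro ⟨k, x, t⟩
  refine ⟨⟨k, (Fintype.equivFin S).symm x, t⟩, ?_⟩
  have h : inPlace ((Fintype.equivFin S).symm x) = x := (Fintype.equivFin S).apply_symm_apply x
  unfold compileMod
  congr 1

theorem represents_start (n : ℕ) (D : Type) :
    R.Represents q n ((R.compile q n).initState (Database.empty _ D)) (R.start n D) where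
  inp _ := rfl
  aux b := by
    ext y
    let := (Database.empty (R.compile q n).inSchema D).toStructure
    change ((R.compile q n).init (auxPlace n b)).Realize y ↔
      y ∈ if R.init b then Set.univ else ∅
    have h : R.initAt n (auxPlace n b) = R.init b := by simp [initAt, auxPlace]
    change Formula.Realize (if R.initAt n (auxPlace n b) then _ else _) y ↔ _
    rw [h]
    cases R.init b <;> simp [Formula.Realize, BoundedFormula.Realize]
  count j hj := by
    ext y
    let := (Database.empty (R.compile q n).inSchema D).toStructure
    change Formula.Realize (if R.initAt n (countPlace B n j) then _ else _) y ↔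
      y ∈ if n ≤ j then Set.univ else ∅
    have h : R.initAt n (countPlace B n j) = decide (n ≤ j) := by
      simp [initAt, countPlace]
    rw [h]
    by_cases hn : n ≤ j <;> simp [hn, Formula.Realize, BoundedFormula.Realize]
  le := le_rfl

omit [Fintype S] in
theorem apply_place {a : ℕ} (e : S ≃ Fin a) (I : Fin a → Set (Fin p → D))
    (I' : S → Set (Fin p → D)) (h : ∀ x, I (e x) = I' x) (δ : RawMod p S D) (x : S) :
    Modification.apply (σ := uniformSchema a p) ⟨δ.kind, e δ.symbol, δ.tuple⟩ I (e x) =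
      δ.apply I' x := by
  classical
  obtain ⟨k, y, t⟩ := δ
  cases k
  · change Function.update I (e y) (I (e y) ∪ {t}) (e x) =
      Function.update I' y (I' y ∪ {t}) x
    by_cases hxy : x = y
    · rw [hxy, Function.update_self, Function.update_self, h]
    · rw [Function.update_of_ne (e.injective.ne hxy), Function.update_of_ne hxy, h]
  · change Function.update I (e y) (I (e y) \ {t}) (e x) =
      Function.update I' y (I' y \ {t}) x
    by_cases hxy : x = y
    · rw [hxy, Function.update_self, Function.update_self, h]
    · rw [Function.update_of_ne (e.injective.ne hxy), Function.update_of_ne hxy, h]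

/-- The shift is correct because `c - 1 ≤ j` means `c ≤ j + 1`. The last symbol has no successor and
reads itself, which is harmless: it is always full, since `c ≤ n`. -/
theorem count_shift {n c j : ℕ} (X : Fin (Fintype.card B + (n + 1)) → Set (Fin r → D))
    (hX : ∀ j ≤ n, X (countPlace B n j) = if c ≤ j then Set.univ else ∅) (hc : c ≤ n) (hj : j ≤ n)
    (b : Prop) [Decidable b] : X (if b then countPlace B n (j + 1) else countPlace B n j) =
      if (if b then c - 1 else c) ≤ j then Set.univ else ∅ := by
  by_cases hb : b
  · simp only [if_pos hb]
    rcases Nat.lt_or_ge j n with hn | hn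
    · rw [hX (j + 1) hn]
      simp only [Nat.sub_le_iff_le_add]
    · have : countPlace B n (j + 1) = countPlace B n n := by
        ext; simp [countPlace]; omega
      rw [this, hX n le_rfl, if_pos hc, if_pos (by omega)]
  · simp only [if_neg hb, hX j hj]

open Classical in
theorem Represents.step {n : ℕ} {s : State (R.compile q n) D} {a : RawState p r S B D}
    (h : R.Represents q n s a) (δ : RawMod p S D) :
    R.Represents q n ((R.compile q n).step s (R.compileMod q n δ)) (R.step a δ) where
  inp x := apply_place (Fintype.equivFin S) s.input a.inp h.inp δ x
  aux b := by
    ext y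
    have hz : s.aux (countPlace B n 0) = if a.count = 0 then Set.univ else ∅ := by
      simp [h.count 0 (Nat.zero_le n)]
    have key := Raw.realize_toFormula inPlace (auxPlace n) (countPlace B n 0) s.input s.aux
      a.inp a.aux a.count h.inp h.aux hz (Sum.elim δ.tuple y) (R.update δ.kind δ.symbol b)
    have hu : (R.compile q n).update δ.kind (inPlace δ.symbol) (auxPlace n b) =
        (R.update δ.kind δ.symbol b).toFormula inPlace (auxPlace n) (countPlace B n 0) := by
      simp [compile, updateAt, auxPlace, inPlace]
    have h1 : y ∈ ((R.compile q n).step s (R.compileMod q n δ)).aux (auxPlace n b) ↔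
      (letI := s.toStructure; ((R.compile q n).update δ.kind (inPlace δ.symbol)
        (auxPlace n b)).Realize (Sum.elim δ.tuple y)) := Iff.rfl
    rw [h1, hu]
    exact key
  count j hj := by
    have hu : (R.compile q n).update δ.kind (inPlace δ.symbol) (countPlace B n j) =
        .rel (l := r) (.inr ⟨if δ.kind = .del ∧ δ.symbol = R.tick then
          countPlace B n (j + 1) else countPlace B n j, rfl⟩) fun t => .var (.inl (.inr t)) := by
      simp [compile, updateAt, countPlace, inPlace, hj]
    have h1 : ((R.compile q n).step s (R.compileMod q n δ)).aux (countPlace B n j) =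
        s.aux (if δ.kind = .del ∧ δ.symbol = R.tick then
          countPlace B n (j + 1) else countPlace B n j) := by
      ext y
      have h2 : y ∈ ((R.compile q n).step s (R.compileMod q n δ)).aux (countPlace B n j) ↔
        (letI := s.toStructure; ((R.compile q n).update δ.kind (inPlace δ.symbol)
          (countPlace B n j)).Realize (Sum.elim δ.tuple y)) := Iff.rfl
      rw [h2, hu]
      exact Iff.rfl
    exact h1.trans (count_shift s.aux h.count h.le hj _)
  le := by
    have := h.le
    simp only [RawProgram.step]
    split_ifs <;> omega

theorem represents_run (n : ℕ) (α : List (RawMod p S D)) :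
    R.Represents q n ((R.compile q n).run (Database.empty _ D) (α.map (R.compileMod q n)))
      (R.run (R.start n D) α) := by
  have : ∀ (s : State (R.compile q n) D) (a : RawState p r S B D), R.Represents q n s a →
      R.Represents q n ((α.map (R.compileMod q n)).foldl (R.compile q n).step s) (R.run a α) := by
    induction α with
    | nil => exact fun _ _ h => h
    | cons δ α ih => exact fun s a h => ih _ _ (h.step R q δ)
  exact this _ _ (R.represents_start q n D)

/-- Emptiness of the compiled program in terms of the raw program. -/
theorem queryAlwaysEmpty_compile (n : ℕ) :
    (R.compile q n).QueryAlwaysEmpty ↔ ∀ (D : Type) [Finite D] [Nonempty D] (α : List (RawMod p S D)),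
      (R.run (R.start n D) α).aux q = ∅ := by
  constructor
  · intro h D _ _ α
    rw [← (R.represents_run q n α).aux]
    exact h D _
  · intro h D _ _ α
    obtain ⟨α, rfl⟩ := (R.compileMod_surjective q n).list_map α
    exact ((R.represents_run q n α).aux _).trans (h D α)

/-! #### The Gödel numbers of compiled programs -/

/-- Replaces an index type that depends on the countdown by natural numbers, where primitive
recursion applies. -/
theorem ofFn_eq_map_range {β : Type} {N : ℕ} (f : Fin N → β) (g : ℕ → β) (h : ∀ i, f i = g i) :
    List.ofFn f = (List.range N).map g := by
  apply List.ext_getElem <;> simp [h]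

/-- A finite table is a constant list, so even values obtained from noncomputable choices, such as
the numbering of symbols, form a primitive recursive function. -/
theorem primrec_table {N : ℕ} (f : Fin N → ℕ) :
    ∃ g : ℕ → ℕ, Primrec g ∧ ∀ i : Fin N, g i = f i := by
  refine ⟨fun i => (List.ofFn f).getD i 0, (Primrec.list_getD 0).comp (.const _) .id, fun i => ?_⟩
  simp [List.getD]

theorem primrec_list {h : ℕ → ℕ → ℕ} (hh : Primrec₂ h) (m : ℕ) :
    Primrec fun n => (List.range (m + (n + 1))).map (h n) :=
  Primrec.list_map (Primrec.list_range.comp (Primrec.nat_add.comp (.const m) .succ)) hh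

theorem primrec_initCodes :
    Primrec fun n => List.ofFn fun i => formulaCode (symbolCode (R.compile q n).inSchema)
      ((R.compile q n).init i) := by
  obtain ⟨g, hg, hgf⟩ := primrec_table fun i : Fin (Fintype.card B) =>
    if R.init ((Fintype.equivFin B).symm i) then 3 else 0
  -- Initialization formulas are only `⊥ → ⊥` and `⊥`, whose codes are `3` and `0`.
  have hprim : Primrec₂ fun n i : ℕ => if i < Fintype.card B then g i else
      if n ≤ i - Fintype.card B then 3 else 0 := by
    refine Primrec.ite (Primrec.nat_lt.comp .snd (.const _)) (hg.comp .snd) ?_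
    exact Primrec.ite (Primrec.nat_le.comp .fst (Primrec.nat_sub.comp .snd (.const _)))
      (.const _) (.const _)
  refine (primrec_list hprim (Fintype.card B)).of_eq fun n => ?_
  refine (ofFn_eq_map_range _ _ fun i => ?_).symm
  have h1 : formulaCode (symbolCode (R.compile q n).inSchema) ((R.compile q n).init i) =
      if R.initAt n i then 3 else 0 := by
    change formulaCode _ (if R.initAt n i then _ else _) = _
    cases R.initAt n i <;> simp [formulaCode, Nat.pair]
  rw [h1]
  unfold initAt
  by_cases h2 : (i : ℕ) < Fintype.card B
  · rw [if_pos h2, dif_pos h2, hgf ⟨i, h2⟩]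
  · simp [h2]

/-- Update formulas of the proper symbols do not vary with `n` and come from a table. Those of the
countdown symbols are single atoms whose place is an arithmetic expression in `n` and `i`. -/
theorem primrec_updateCodes (k : OpKind) (s : Fin (Fintype.card S)) :
    ∃ h : ℕ → ℕ → ℕ, Primrec₂ h ∧ ∀ n i, formulaCode (combinedSymbolCode _ _)
      (R.updateAt n k s i) = h n i := by
  classical
  obtain ⟨m, hm⟩ : ∃ m, m = Fintype.card B := ⟨_, rfl⟩
  obtain ⟨g, hg, hgf⟩ := primrec_table fun i : Fin (Fintype.card B) =>
    (R.update k ((Fintype.equivFin S).symm s) ((Fintype.equivFin B).symm i)).code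
      (fun s => inPlace s) (fun b => Fintype.equivFin B b) (Fintype.card B)
  obtain ⟨c, hc⟩ : ∃ c, c = Encodable.encode (List.ofFn fun i : Fin r =>
    Encodable.encode (.inl (.inr i) : (Fin p ⊕ Fin r) ⊕ Fin 0)) := ⟨_, rfl⟩
  have hrel : ∀ j : ℕ → ℕ → ℕ, Primrec₂ j →
      Primrec₂ fun n i => if i < m then g i else 4 * Nat.pair (2 * j n i + 1) c + 2 := by
    intro j hj
    have h1 : Primrec fun x : ℕ × ℕ => 4 * Nat.pair (2 * j x.1 x.2 + 1) c + 2 :=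
      Primrec.nat_add.comp (Primrec.nat_mul.comp (.const 4) (Primrec₂.natPair.comp
        (Primrec.nat_add.comp (Primrec.nat_mul.comp (.const 2) hj) (.const 1)) (.const c)))
        (.const 2)
    exact Primrec.ite (Primrec.nat_lt.comp .snd (.const m)) (hg.comp .snd) h1
  have hmin : Primrec₂ fun n i : ℕ => m + min (i - m + 1) n :=
    Primrec.nat_add.comp (.const m) (Primrec.nat_min.comp (Primrec.succ.comp
      (Primrec.nat_sub.comp .snd (.const m))) .fst)
  by_cases hk : k = .del ∧ (Fintype.equivFin S).symm s = R.tick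
  · refine ⟨fun n i => if i < m then g i else 4 * Nat.pair (2 * (m + min (i - m + 1) n) + 1) c + 2,
      hrel _ hmin, fun n i => ?_⟩
    subst hm
    beta_reduce
    by_cases hi : (i : ℕ) < Fintype.card B
    · rw [if_pos hi, hgf ⟨i, hi⟩]
      simp only [updateAt]
      rw [dif_pos hi, Raw.formulaCode_toFormula]
      simp [auxPlace, countPlace]
    · rw [if_neg hi]
      simp only [updateAt]
      rw [dif_neg hi]
      simp only [if_pos hk]
      rw [hc]
      rfl
  · refine ⟨fun n i => if i < m then g i else 4 * Nat.pair (2 * i + 1) c + 2,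
      hrel (fun _ i => i) .snd, fun n i => ?_⟩
    subst hm
    beta_reduce
    by_cases hi : (i : ℕ) < Fintype.card B
    · rw [if_pos hi, hgf ⟨i, hi⟩]
      simp only [updateAt]
      rw [dif_pos hi, Raw.formulaCode_toFormula]
      simp [auxPlace, countPlace]
    · rw [if_neg hi]
      simp only [updateAt]
      rw [dif_neg hi]
      simp only [if_neg hk]
      rw [hc]
      rfl

theorem primrec_updateLists :
    Primrec fun n => List.ofFn fun s => List.ofFn fun i =>
      (formulaCode (combinedSymbolCode _ _) ((R.compile q n).update .ins s i),
        formulaCode (combinedSymbolCode _ _) ((R.compile q n).update .del s i)) := by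
  choose h1 hp1 hh1 using R.primrec_updateCodes .ins
  choose h2 hp2 hh2 using R.primrec_updateCodes .del
  have h : ∀ s, Primrec fun n =>
      (List.range (Fintype.card B + (n + 1))).map fun i => (h1 s n i, h2 s n i) := fun s =>
    Primrec.list_map (Primrec.list_range.comp (Primrec.nat_add.comp (.const _) .succ))
      (Primrec.pair (hp1 s) (hp2 s))
  refine (Primrec.list_ofFn h).of_eq fun n => congrArg List.ofFn (funext fun s => ?_)
  exact (ofFn_eq_map_range _ _ fun i => Prod.ext (hh1 s n i) (hh2 s n i)).symm

/-- The Gödel number of the compiled program is primitive recursive in the countdown. -/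
theorem primrec_code : Primrec fun n => (R.compile q n).code := by
  have haux : Primrec fun n => (R.compile q n).auxSchema.arityList := by
    refine (primrec_list (h := fun _ _ => r) (.const r) (Fintype.card B)).of_eq fun n => ?_
    exact (ofFn_eq_map_range _ _ fun i => rfl).symm
  have hq : Primrec fun n => ((R.compile q n).query : ℕ) :=
    Primrec.const (Fintype.equivFin B q : ℕ)
  exact Primrec.encode.comp ((Primrec.const (List.ofFn fun _ : Fin (Fintype.card S) => p)).pair
    (haux.pair (hq.pair ((R.primrec_initCodes q).pair (R.primrec_updateLists q)))))

/-- A decision procedure for emptiness decides, in the countdown, emptiness of compiled programs. -/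
theorem computablePred_of_emptinessDecidable {C : Set DynProgram} (hC : ∀ n, R.compile q n ∈ C)
    (h : EmptinessDecidable C) : ComputablePred fun n => (R.compile q n).QueryAlwaysEmpty := by
  classical
  obtain ⟨f, hf, hfC⟩ := h
  refine ⟨inferInstance, (hf.comp (R.primrec_code q).to_comp).of_eq fun n => ?_⟩
  rw [Bool.eq_iff_iff, hfC _ (hC n), decide_eq_true_iff]

end RawProgram
end DynComplexity

/-! ### Languages of regular expressions are regular -/

namespace Language

open Computability

variable {α : Type}

/-- The Myhill–Nerode criterion, in the form used for every closure property below. -/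
theorem isRegular_of_leftQuotient_mem {L : Language α} {T : Set (Language α)} (hT : T.Finite)
    (h : ∀ x, L.leftQuotient x ∈ T) : L.IsRegular :=
  .of_finite_range_leftQuotient (hT.subset (Set.range_subset_iff.2 h))

/-- In a factorization of `x ++ y`, the factor from `L` ends either beyond `x` or within it. -/
theorem leftQuotient_mul (L M : Language α) (x : List α) :
    (L * M).leftQuotient x =
      L.leftQuotient x * M + sSup {K | ∃ u v, x = u ++ v ∧ u ∈ L ∧ K = M.leftQuotient v} := by
  ext y
  change x ++ y ∈ L * M ↔ y ∈ L.leftQuotient x * M ∨ y ∈ sSup _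
  simp only [mem_mul]
  constructor
  · rintro ⟨a, ha, b, hb, h⟩
    rcases List.append_eq_append_iff.1 h with ⟨c, rfl, rfl⟩ | ⟨c, rfl, rfl⟩
    · exact .inr ⟨_, ⟨a, c, rfl, ha, rfl⟩, hb⟩
    · exact .inl ⟨c, ha, b, hb, rfl⟩
  · rintro (⟨a, ha, b, hb, rfl⟩ | ⟨_, ⟨u, v, rfl, hu, rfl⟩, hy⟩)
    · exact ⟨x ++ a, ha, b, hb, by simp⟩
    · exact ⟨u, hu, v ++ y, hy, by simp⟩

/-- By `leftQuotient_mul`, a left quotient of the product is determined by one left quotient of `L`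
and a set of left quotients of `M`, which leaves finitely many possibilities. -/
theorem IsRegular.mul {L M : Language α} (hL : L.IsRegular) (hM : M.IsRegular) :
    (L * M).IsRegular := by
  refine isRegular_of_leftQuotient_mem (T := (fun q : Language α × Set (Language α) =>
    q.1 * M + sSup q.2) '' (Set.range L.leftQuotient ×ˢ 𝒫 Set.range M.leftQuotient))
    ((hL.finite_range_leftQuotient.prod hM.finite_range_leftQuotient.finite_subsets).image _)
    fun x => ⟨(_, _), ⟨⟨x, rfl⟩, ?_⟩, (leftQuotient_mul L M x).symm⟩
  rintro _ ⟨u, v, -, -, rfl⟩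
  exact ⟨v, rfl⟩

/-- Among the factors, one contains the end of `x`: it splits into a final part `v` of `x` and a
beginning of `y`. If `x` ends at a boundary, the factor before the boundary is taken. Nonemptiness
of `x` guarantees that there is such a factor. -/
theorem exists_of_append_flatten {L : Language α} {y : List α} {l : List (List α)} :
    ∀ {x : List α}, (∀ w ∈ l, w ∈ L) → x ≠ [] → l.flatten = x ++ y →
      ∃ u v, x = u ++ v ∧ u ∈ L∗ ∧ y ∈ L.leftQuotient v * L∗ := by
  induction l with
  | nil => intro x _ hx h; simp_all
  | cons b l ih =>
    intro x hl hx h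
    have hb := hl b (by simp)
    have hl' : ∀ w ∈ l, w ∈ L := fun w hw => hl w (by simp [hw])
    rw [List.flatten_cons] at h
    rcases List.append_eq_append_iff.1 h with ⟨c, rfl, hc⟩ | ⟨c, rfl, rfl⟩
    · rcases eq_or_ne c [] with rfl | hc'
      · refine ⟨[], b, by simp, nil_mem_kstar L, [], show b ++ [] ∈ L by rwa [List.append_nil], y, ?_, rfl⟩
        exact ⟨l, by simpa using hc.symm, hl'⟩
      · obtain ⟨u, v, rfl, ⟨l', rfl, hl''⟩, hy⟩ := ih hl' hc' hc
        exact ⟨b ++ l'.flatten, v, by simp, ⟨b :: l', rfl, by simpa [hb] using hl''⟩, hy⟩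
    · exact ⟨[], x, rfl, nil_mem_kstar L, c, hb, l.flatten, ⟨l, rfl, hl'⟩, rfl⟩

theorem leftQuotient_kstar {L : Language α} {x : List α} (hx : x ≠ []) :
    L∗.leftQuotient x =
      sSup {K | ∃ u v, x = u ++ v ∧ u ∈ L∗ ∧ K = L.leftQuotient v} * L∗ := by
  ext y
  constructor
  · rintro ⟨l, hl, h⟩
    obtain ⟨u, v, hu, hu', a, ha, b, hb, rfl⟩ := exists_of_append_flatten h hx hl.symm
    exact ⟨a, ⟨_, ⟨u, v, hu, hu', rfl⟩, ha⟩, b, hb, rfl⟩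
  · rintro ⟨a, ⟨_, ⟨u, v, rfl, ⟨l, rfl, hl⟩, rfl⟩, ha⟩, _, ⟨l', rfl, hl'⟩, rfl⟩
    refine ⟨l ++ (v ++ a) :: l', by simp, fun w hw => ?_⟩
    rcases List.mem_append.1 hw with hw | hw
    · exact hl w hw
    · rcases List.mem_cons.1 hw with rfl | hw
      · exact ha
      · exact hl' w hw

theorem IsRegular.kstar {L : Language α} (hL : L.IsRegular) : (L∗).IsRegular := by
  -- The quotient by the empty word is listed apart, as `leftQuotient_kstar` covers nonempty words
  -- only.
  refine isRegular_of_leftQuotient_mem (T := insert L∗ ((fun q : Set (Language α) => sSup q * L∗) ''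
    (𝒫 Set.range L.leftQuotient))) ((hL.finite_range_leftQuotient.finite_subsets.image _).insert _)
    fun x => ?_
  rcases eq_or_ne x [] with rfl | hx
  · exact .inl (leftQuotient_nil _)
  · refine .inr ⟨_, ?_, (leftQuotient_kstar hx).symm⟩
    rintro _ ⟨u, v, -, -, rfl⟩
    exact ⟨v, rfl⟩

/-- All left quotients consist of suffixes of words of `L`, and there are finitely many such
suffixes. -/
theorem isRegular_of_finite {L : Language α} (hL : Set.Finite (L : Set (List α))) :
    L.IsRegular := by
  refine isRegular_of_leftQuotient_mem (T := 𝒫 {y | ∃ z ∈ L, y ∈ {y | y <:+ z}})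
    (Set.Finite.finite_subsets ?_) fun x y hy => ⟨_, hy, x, rfl⟩
  have : {y : List α | ∃ z ∈ L, y ∈ {y | y <:+ z}} = ⋃ z ∈ L, {y | y <:+ z} := by ext; simp
  rw [this]
  refine hL.biUnion fun z _ => ?_
  have h2 : {y | y <:+ z} = {y | y ∈ z.tails} := by ext; simp
  rw [h2]
  exact z.tails.finite_toSet

end Language

theorem RegularExpression.isRegular_matches' {α : Type} (P : RegularExpression α) :
    P.matches'.IsRegular := by
  induction P with
  | zero => exact Language.isRegular_of_finite Set.finite_empty
  | epsilon => exact Language.isRegular_of_finite (Set.finite_singleton _)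
  | char a => exact Language.isRegular_of_finite (Set.finite_singleton _)
  | plus P Q hP hQ => exact hP.add hQ
  | comp P Q hP hQ => exact hP.mul hQ
  | star P hP => exact hP.kstar

/-- Substitution of words for letters in a regular expression. -/
def RegularExpression.subst {α β : Type} (h : α → List β) :
    RegularExpression α → RegularExpression β
  | 0 => 0
  | 1 => 1
  | char a => (h a).foldr (fun b R => char b * R) 1
  | P + Q => P.subst h + Q.subst h
  | P * Q => P.subst h * Q.subst h
  | star P => star (P.subst h)

theorem RegularExpression.matches'_foldr_char {β : Type} (w : List β) :
    (w.foldr (fun b R => char b * R) 1 : RegularExpression β).matches' = {w} := by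
  induction w with
  | nil => rfl
  | cons b w ih =>
    rw [List.foldr_cons, matches'_mul, ih, matches'_char]
    ext x
    rw [Language.mem_mul]
    constructor
    · rintro ⟨_, rfl, _, rfl, rfl⟩
      rfl
    · rintro rfl
      exact ⟨_, rfl, _, rfl, rfl⟩

theorem RegularExpression.mem_matches'_subst {α β : Type} (h : α → List β)
    (P : RegularExpression α) (x : List β) :
    x ∈ (P.subst h).matches' ↔ ∃ w ∈ P.matches', w.flatMap h = x := by
  induction P generalizing x with
  | zero => exact ⟨fun h => h.elim, fun ⟨_, h, _⟩ => h.elim⟩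
  | epsilon =>
    refine ⟨fun h => ⟨[], rfl, h.symm⟩, ?_⟩
    rintro ⟨w, hw, rfl⟩
    cases (show w = [] from hw)
    rfl
  | char a =>
    change x ∈ ((h a).foldr (fun b R => char b * R) 1 : RegularExpression β).matches' ↔ _
    rw [matches'_foldr_char]
    refine ⟨fun hx => ⟨[a], rfl, by simpa using (show x = h a from hx).symm⟩, ?_⟩
    rintro ⟨w, hw, rfl⟩
    cases (show w = [a] from hw)
    exact List.flatMap_singleton ..
  | plus P Q hP hQ =>
    change x ∈ (P.subst h).matches' ∨ x ∈ (Q.subst h).matches' ↔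
      ∃ w, (w ∈ P.matches' ∨ w ∈ Q.matches') ∧ _
    rw [hP, hQ]
    constructor
    · rintro (⟨w, h1, h2⟩ | ⟨w, h1, h2⟩)
      · exact ⟨w, .inl h1, h2⟩
      · exact ⟨w, .inr h1, h2⟩
    · rintro ⟨w, h1 | h1, h2⟩
      · exact .inl ⟨w, h1, h2⟩
      · exact .inr ⟨w, h1, h2⟩
  | comp P Q hP hQ =>
    change x ∈ (P.subst h).matches' * (Q.subst h).matches' ↔
      ∃ w ∈ P.matches' * Q.matches', _
    simp only [Language.mem_mul, hP, hQ]
    constructor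
    · rintro ⟨_, ⟨u, hu, rfl⟩, _, ⟨v, hv, rfl⟩, rfl⟩
      exact ⟨u ++ v, ⟨u, hu, v, hv, rfl⟩, by simp⟩
    · rintro ⟨_, ⟨u, hu, v, hv, rfl⟩, rfl⟩
      exact ⟨_, ⟨u, hu, rfl⟩, _, ⟨v, hv, rfl⟩, by simp⟩
  | star P hP =>
    change x ∈ KStar.kstar (P.subst h).matches' ↔ ∃ w ∈ KStar.kstar P.matches', _
    simp only [Language.mem_kstar, hP]
    constructor
    · rintro ⟨l, rfl, hl⟩
      choose! f hf hfh using hl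
      refine ⟨(l.map f).flatten, ⟨_, rfl, by simpa using hf⟩, ?_⟩
      rw [List.flatMap_def, List.map_flatten, List.flatten_flatten, List.map_map, List.map_map]
      congr 1
      conv_rhs => rw [← List.map_id l]
      exact List.map_congr_left fun y hy => hfh y hy
    · rintro ⟨_, ⟨l, rfl, hl⟩, rfl⟩
      refine ⟨l.map fun w => w.flatMap h, ?_, ?_⟩
      · simp [List.flatMap_def, List.map_flatten, List.flatten_flatten, Function.comp_def]
      · intro y hy
        obtain ⟨w, hw, rfl⟩ := List.mem_map.1 hy
        exact ⟨w, hl w hw, rfl⟩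

namespace DynComplexity

/-- Renaming of the auxiliary symbols. -/
def Raw.map {p r : ℕ} {S B B' : Type} (g : B → B') : Raw p r S B → Raw p r S B'
  | .bot => .bot
  | .eq u v => .eq u v
  | .inp s t => .inp s t
  | .aux b t => .aux (g b) t
  | .zero => .zero
  | .diag s => .diag s
  | .imp φ ψ => .imp (φ.map g) (ψ.map g)

@[simp] theorem Raw.eval_map {p r : ℕ} {S B B' D : Type} (g : B → B') (I : S → Set (Fin p → D))
    (X : B' → Set (Fin r → D)) (c : ℕ) (ν : Fin p ⊕ Fin r → D) :
    ∀ φ : Raw p r S B, (φ.map g).Eval I X c ν ↔ φ.Eval I (fun b => X (g b)) c ν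
  | .bot => Iff.rfl
  | .eq _ _ => Iff.rfl
  | .inp _ _ => Iff.rfl
  | .aux _ _ => Iff.rfl
  | .zero => Iff.rfl
  | .diag _ => Iff.rfl
  | .imp φ ψ => imp_congr (eval_map g I X c ν φ) (eval_map g I X c ν ψ)

@[simp] theorem Raw.qf_map {p r : ℕ} {S B B' : Type} (g : B → B') :
    ∀ φ : Raw p r S B, (φ.map g).QF ↔ φ.QF
  | .bot => Iff.rfl
  | .eq _ _ => Iff.rfl
  | .inp _ _ => Iff.rfl
  | .aux _ _ => Iff.rfl
  | .zero => Iff.rfl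
  | .diag _ => Iff.rfl
  | .imp φ ψ => and_congr (qf_map g φ) (qf_map g ψ)

/-! ### Programs controlled by an automaton -/

/-- A raw program with an alphabet `Λ` of actions. An action is an operation on a symbol, allowed
for the tuples that satisfy its guard. -/
structure Gadget (p r : ℕ) (S A Λ : Type) extends RawProgram p r S A where
  kind : Λ → OpKind
  symbol : Λ → S
  guard : Λ → Raw p r S A

namespace Gadget

variable {p r : ℕ} {S A Λ D : Type} (G : Gadget p r S A Λ)

/-- `G.Match y s w α`: the modifications `α` perform the actions `w` from the state `s`, and each
guard holds when its turn comes. The tuple `y` interprets variables of guards outside `α`. -/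
def Match (y : Fin r → D) : RawState p r S A D → List Λ → List (RawMod p S D) → Prop
  | _, [], [] => True
  | s, a :: w, δ :: α => δ.kind = G.kind a ∧ δ.symbol = G.symbol a ∧
      (G.guard a).Eval s.inp s.aux s.count (Sum.elim δ.tuple y) ∧ Match y (G.step s δ) w α
  | _, _, _ => False

variable {Q : Type} [Fintype Λ] [Fintype Q] (M : DFA Λ Q)

open Classical in
/-- The update formula of the bit for the automaton state `q`. -/
noncomputable def bitUpdate (k : OpKind) (s : S) (q : Q) : Raw p r S (A ⊕ Option Q) :=
  .any (fun x : Λ × Q => .and ((G.guard x.1).map .inl) (.aux (.inr (some x.2)) .inr))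
    (Finset.univ.filter fun x : Λ × Q => G.kind x.1 = k ∧ G.symbol x.1 = s ∧
      M.step x.2 x.1 = q).toList

open Classical in
/-- The gadget together with a bit for each state of an automaton that reads actions, and a query
bit for acceptance. -/
noncomputable def control : RawProgram p r S (A ⊕ Option Q) where
  tick := G.tick
  update k s
    | .inl a => (G.update k s a).map .inl
    | .inr (some q) => G.bitUpdate M k s q
    -- All updates read the old state, so the query cannot consult the new state bits and recomputes
    -- those of the accepting states.
    | .inr none => .any (G.bitUpdate M k s) (Finset.univ.filter (· ∈ M.accept)).toList
  init
    | .inl a => G.init a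
    | .inr (some q) => decide (q = M.start)
    | .inr none => decide (M.start ∈ M.accept)

/-- All formulas of the gadget are quantifier-free. -/
def QF : Prop := (∀ k s a, (G.update k s a).QF) ∧ ∀ a, (G.guard a).QF

theorem qf_bitUpdate (h : G.QF) (k : OpKind) (s : S) (q : Q) : (G.bitUpdate M k s q).QF :=
  Raw.qf_any _ _ fun x _ => by simpa using h.2 x.1

theorem qf_control (h : G.QF) (k : OpKind) (s : S) : ∀ b, ((G.control M).update k s b).QF
  | .inl a => (Raw.qf_map _ _).2 (h.1 k s a)
  | .inr (some q) => G.qf_bitUpdate M h k s q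
  | .inr none => Raw.qf_any _ _ fun q _ => G.qf_bitUpdate M h k s q

/-- The state of the gadget within a state of the controlled program. -/
def proj (s : RawState p r S (A ⊕ Option Q) D) : RawState p r S A D :=
  ⟨s.inp, fun a => s.aux (.inl a), s.count⟩

theorem proj_step (s : RawState p r S (A ⊕ Option Q) D) (δ : RawMod p S D) :
    proj ((G.control M).step s δ) = G.step (proj s) δ := by
  simp only [proj, RawProgram.step, RawState.mk.injEq]
  refine ⟨trivial, ?_, rfl⟩
  funext a
  ext y
  exact Raw.eval_map _ _ _ _ _ _

theorem mem_step_bit (s : RawState p r S (A ⊕ Option Q) D) (δ : RawMod p S D) (q : Q)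
    (y : Fin r → D) : y ∈ ((G.control M).step s δ).aux (.inr (some q)) ↔
      ∃ a q', δ.kind = G.kind a ∧ δ.symbol = G.symbol a ∧ M.step q' a = q ∧
        (G.guard a).Eval (proj s).inp (proj s).aux (proj s).count (Sum.elim δ.tuple y) ∧
        y ∈ s.aux (.inr (some q')) := by
  change (G.bitUpdate M δ.kind δ.symbol q).Eval s.inp s.aux s.count (Sum.elim δ.tuple y) ↔ _
  simp only [bitUpdate, Raw.eval_any, Raw.eval_and, Raw.eval_map, Raw.eval_aux,
    Finset.mem_toList, Finset.mem_filter, Finset.mem_univ, true_and, Prod.exists, proj]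
  constructor
  · rintro ⟨a, q', ⟨h1, h2, h3⟩, h4, h5⟩
    exact ⟨a, q', h1.symm, h2.symm, h3, h4, h5⟩
  · rintro ⟨a, q', h1, h2, h3, h4, h5⟩
    exact ⟨a, q', ⟨h1.symm, h2.symm, h3⟩, h4, h5⟩

/-- This is the subset construction: one modification may perform several actions, so the bits hold
all automaton states that some reading of the modifications reaches. It takes place separately for
every tuple `y`, because bits have the common arity `r`. -/
theorem mem_run_bit (α : List (RawMod p S D)) (q : Q) (y : Fin r → D) :
    ∀ s : RawState p r S (A ⊕ Option Q) D, y ∈ ((G.control M).run s α).aux (.inr (some q)) ↔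
      ∃ w q', G.Match y (proj s) w α ∧ y ∈ s.aux (.inr (some q')) ∧ M.evalFrom q' w = q := by
  induction α with
  | nil =>
    intro s
    constructor
    · exact fun h => ⟨[], q, trivial, h, rfl⟩
    · rintro ⟨_ | _, q', h1, h2, rfl⟩
      · exact h2
      · exact h1.elim
  | cons δ α ih =>
    intro s
    refine (ih ((G.control M).step s δ)).trans ?_
    simp only [mem_step_bit, proj_step]
    constructor
    · rintro ⟨w, q', h1, ⟨a, q'', h2, h3, rfl, h4, h5⟩, rfl⟩
      exact ⟨a :: w, q'', ⟨h2, h3, h4, h1⟩, h5, rfl⟩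
    · rintro ⟨_ | ⟨a, w⟩, q', h1, h2, rfl⟩
      · exact h1.elim
      · exact ⟨w, _, h1.2.2.2, ⟨a, q', h1.1, h1.2.1, rfl, h1.2.2.1, h2⟩, rfl⟩

theorem mem_run_query (α : List (RawMod p S D)) (y : Fin r → D) :
    ∀ s : RawState p r S (A ⊕ Option Q) D,
      (y ∈ s.aux (.inr none) ↔ ∃ q ∈ M.accept, y ∈ s.aux (.inr (some q))) →
      (y ∈ ((G.control M).run s α).aux (.inr none) ↔
        ∃ q ∈ M.accept, y ∈ ((G.control M).run s α).aux (.inr (some q))) := by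
  induction α with
  | nil => exact fun _ h => h
  | cons δ α ih =>
    refine fun s _ => ih _ ?_
    change ((G.control M).update δ.kind δ.symbol (.inr none)).Eval _ _ _ _ ↔
      ∃ q ∈ M.accept, ((G.control M).update δ.kind δ.symbol (.inr (some q))).Eval _ _ _ _
    simp [control]

theorem mem_query (n : ℕ) (α : List (RawMod p S D)) (y : Fin r → D) :
    y ∈ ((G.control M).run ((G.control M).start n D) α).aux (.inr none) ↔
      ∃ w ∈ M.accepts, G.Match y (G.start n D) w α := by
  rw [mem_run_query]
  · simp only [mem_run_bit]
    constructor
    · rintro ⟨_, hq, w, q', h1, h2, rfl⟩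
      have : q' = M.start := by
        by_contra h
        simp [RawProgram.start, control, h] at h2
      subst this
      exact ⟨w, hq, h1⟩
    · rintro ⟨w, hw, h⟩
      exact ⟨_, hw, w, M.start, h, by simp [RawProgram.start, control], rfl⟩
  · by_cases h : M.start ∈ M.accept
    · exact iff_of_true (by simp [RawProgram.start, control, h])
        ⟨_, h, by simp [RawProgram.start, control]⟩
    · simp only [RawProgram.start, control, h]
      have : ∀ q ∈ M.accept, q ≠ M.start := fun q hq h' => h (h' ▸ hq)
      simp only [decide_false, Bool.false_eq_true, if_false, Set.mem_empty_iff_false, false_iff]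
      rintro ⟨q, hq, h'⟩
      simp [this q hq] at h'

omit [Fintype Λ] in
/-- Some actions with sequence in `L` can be performed with countdown from `n`. -/
def Feasible (L : Language Λ) (n : ℕ) : Prop :=
  ∃ D : Type, Finite D ∧ ∃ (y : Fin r → D) (w : List Λ) (α : List (RawMod p S D)),
    Nonempty D ∧ w ∈ L ∧ G.Match y (G.start n D) w α

theorem queryAlwaysEmpty_control [Fintype S] [Fintype A] (n : ℕ) :
    ((G.control M).compile (.inr none) n).QueryAlwaysEmpty ↔ ¬ G.Feasible M.accepts n := by
  rw [RawProgram.queryAlwaysEmpty_compile]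
  constructor
  · rintro h ⟨D, _, y, w, α, _, hw, hα⟩
    have := (G.mem_query M n α y).2 ⟨w, hw, hα⟩
    rw [h D α] at this
    exact this
  · intro h D _ _ α
    rw [Set.eq_empty_iff_forall_notMem]
    intro y hy
    obtain ⟨w, hw, hα⟩ := (G.mem_query M n α y).1 hy
    exact h ⟨D, inferInstance, y, w, α, inferInstance, hw, hα⟩

theorem computablePred_feasible [Fintype S] [Fintype A] {C : Set DynProgram}
    (hC : ∀ n, (G.control M).compile (.inr none) n ∈ C) (h : EmptinessDecidable C) :
    ComputablePred (G.Feasible M.accepts) :=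
  ((RawProgram.computablePred_of_emptinessDecidable _ _ hC h).not).of_eq fun n => by
    rw [queryAlwaysEmpty_control, not_not]

theorem not_emptinessDecidable_dynFO [Fintype S] [Fintype A] {L : Language Λ}
    (hL : L.IsRegular) (h : ¬ ComputablePred (G.Feasible L)) :
    ¬ EmptinessDecidable (DynFO p r) := by
  obtain ⟨Q, _, M, rfl⟩ := hL
  exact fun hd => h (G.computablePred_feasible M
    (fun n => RawProgram.compile_mem_dynFO _ _ n) hd)

theorem not_emptinessDecidable_dynProp [Fintype S] [Fintype A] {L : Language Λ}
    (hL : L.IsRegular) (hG : G.QF) (h : ¬ ComputablePred (G.Feasible L)) :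
    ¬ EmptinessDecidable (DynProp p r) := by
  obtain ⟨Q, _, M, rfl⟩ := hL
  exact fun hd => h (G.computablePred_feasible M
    (fun n => RawProgram.compile_mem_dynProp _ _ (G.qf_control M hG) n) hd)

end Gadget
end DynComplexity

namespace DynComplexity

/-! ### Counter programs -/

/-- Instructions of counter programs: operations on counters `ι`, and on a countdown that cannot be
increased. -/
inductive Op (ι : Type) : Type
  | inc (i : ι)
  | dec (i : ι)
  | zero (i : ι)
  | tick
  | done
  deriving Fintype

/-- The effect of an instruction on the countdown and the counters. A decrement fails at zero, a
zero test fails elsewhere. -/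
def Op.Step {ι : Type} [DecidableEq ι] : Op ι → ℕ × (ι → ℕ) → ℕ × (ι → ℕ) → Prop
  | inc i, s, s' => s' = (s.1, Function.update s.2 i (s.2 i + 1))
  | dec i, s, s' => s.2 i ≠ 0 ∧ s' = (s.1, Function.update s.2 i (s.2 i - 1))
  | zero i, s, s' => s.2 i = 0 ∧ s' = s
  | tick, s, s' => s.1 ≠ 0 ∧ s' = (s.1 - 1, s.2)
  | done, s, s' => s.1 = 0 ∧ s' = s

/-- The effect of a sequence of instructions. -/
def Steps {ι : Type} [DecidableEq ι] : List (Op ι) → ℕ × (ι → ℕ) → ℕ × (ι → ℕ) → Prop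
  | [], s, s' => s' = s
  | a :: w, s, s' => ∃ t, a.Step s t ∧ Steps w t s'

theorem steps_append {ι : Type} [DecidableEq ι] (u v : List (Op ι)) (s s' : ℕ × (ι → ℕ)) :
    Steps (u ++ v) s s' ↔ ∃ t, Steps u s t ∧ Steps v t s' := by
  induction u generalizing s with
  | nil => simp [Steps]
  | cons a u ih =>
    simp only [List.cons_append, Steps, ih]
    constructor
    · rintro ⟨t, h1, t', h2, h3⟩
      exact ⟨t', ⟨t, h1, h2⟩, h3⟩
    · rintro ⟨t', ⟨t, h1, h2⟩, h3⟩
      exact ⟨t, h1, t', h2, h3⟩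

open RegularExpression

/-- The transition relation of a regular expression over instructions. -/
def Trans {ι : Type} [DecidableEq ι] (P : RegularExpression (Op ι)) (s s' : ℕ × (ι → ℕ)) : Prop :=
  ∃ w ∈ P.matches', Steps w s s'

section
variable {ι : Type} [DecidableEq ι] {s t s' : ℕ × (ι → ℕ)} {P Q : RegularExpression (Op ι)}

theorem trans_char (a : Op ι) : Trans (char a) s s' ↔ a.Step s s' := by
  constructor
  · rintro ⟨w, hw, h⟩
    cases (show w = [a] from hw)
    obtain ⟨t, h, rfl⟩ := h
    exact h
  · exact fun h => ⟨[a], rfl, s', h, rfl⟩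

theorem trans_one : Trans (1 : RegularExpression (Op ι)) s s' ↔ s' = s := by
  constructor
  · rintro ⟨w, hw, h⟩
    cases (show w = [] from hw)
    exact h
  · exact fun h => ⟨[], rfl, h⟩

theorem trans_mul : Trans (P * Q) s s' ↔ ∃ t, Trans P s t ∧ Trans Q t s' := by
  constructor
  · rintro ⟨_, ⟨u, hu, v, hv, rfl⟩, h⟩
    obtain ⟨t, h1, h2⟩ := (steps_append _ _ _ _).1 h
    exact ⟨t, ⟨u, hu, h1⟩, ⟨v, hv, h2⟩⟩
  · rintro ⟨t, ⟨u, hu, h1⟩, ⟨v, hv, h2⟩⟩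
    exact ⟨u ++ v, ⟨u, hu, v, hv, rfl⟩, (steps_append _ _ _ _).2 ⟨t, h1, h2⟩⟩

/-- Macros have exactly one outcome where they are used; this rule executes them symbolically, one
after another. -/
theorem trans_mul_of_det (h : ∀ s', Trans P s s' ↔ s' = t) : Trans (P * Q) s s' ↔ Trans Q t s' := by
  simp [trans_mul, h]

theorem trans_star : Trans (star P) s s' ↔ Relation.ReflTransGen (Trans P) s s' := by
  constructor
  · rintro ⟨_, ⟨l, rfl, hl⟩, h⟩
    induction l generalizing s with
    | nil => cases h; exact .refl
    | cons w l ih =>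
      obtain ⟨t, h1, h2⟩ := (steps_append _ _ _ _).1 h
      exact .head ⟨w, hl w (by simp), h1⟩ (ih (fun y hy => hl y (by simp [hy])) h2)
  · intro h
    induction h using Relation.ReflTransGen.head_induction_on with
    | refl => exact ⟨[], ⟨[], rfl, by simp⟩, rfl⟩
    | head h1 _ ih =>
      obtain ⟨w, hw, h1⟩ := h1
      obtain ⟨_, ⟨l, rfl, hl⟩, h2⟩ := ih
      exact ⟨_, ⟨w :: l, rfl, by simpa [hw] using hl⟩, (steps_append _ _ _ _).2 ⟨_, h1, h2⟩⟩

omit [DecidableEq ι] in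
/-- Repeat `P` as long as the counter `i` can be decreased. -/
def loop (i : ι) (P : RegularExpression (Op ι)) : RegularExpression (Op ι) :=
  .star (char (.dec i) * P) * char (.zero i)

/-- The star may stop after any number of rounds, but the closing zero test rejects an early stop
and the failing decrement prevents further rounds. Hence the loop follows the trajectory `u` up to
the first zero of the counter `i`, and has no outcome if there is none. -/
theorem trans_loop {i : ι} (u : ℕ → ℕ × (ι → ℕ))
    (h : ∀ k, (u k).2 i ≠ 0 →
      ∀ s', Trans P ((u k).1, Function.update (u k).2 i ((u k).2 i - 1)) s' ↔ s' = u (k + 1)) :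
    Trans (loop i P) (u 0) s' ↔ ∃ n, (∀ k < n, (u k).2 i ≠ 0) ∧ (u n).2 i = 0 ∧ s' = u n := by
  have key : ∀ s t, Trans (char (.dec i) * P) s t ↔
      s.2 i ≠ 0 ∧ Trans P (s.1, Function.update s.2 i (s.2 i - 1)) t := by
    intro s t
    simp only [trans_mul, trans_char, Op.Step]
    constructor
    · rintro ⟨_, ⟨h, rfl⟩, h'⟩
      exact ⟨h, h'⟩
    · rintro ⟨h, h'⟩
      exact ⟨_, ⟨h, rfl⟩, h'⟩
  simp only [loop, trans_mul, trans_star, trans_char, Op.Step]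
  constructor
  · rintro ⟨t, h1, h2, rfl⟩
    suffices ∃ n, (∀ k < n, (u k).2 i ≠ 0) ∧ s' = u n by
      obtain ⟨n, hn, rfl⟩ := this
      exact ⟨n, hn, h2, rfl⟩
    clear h2
    induction h1 with
    | refl => exact ⟨0, by simp, rfl⟩
    | tail _ h3 ih =>
      obtain ⟨n, hn, rfl⟩ := ih
      obtain ⟨h4, h5⟩ := (key _ _).1 h3
      refine ⟨n + 1, fun k hk => ?_, (h n h4 _).1 h5⟩
      rcases Nat.lt_succ_iff_lt_or_eq.1 hk with hk | rfl
      · exact hn k hk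
      · exact h4
  · rintro ⟨n, hn, h0, rfl⟩
    refine ⟨_, ?_, h0, rfl⟩
    clear h0
    induction n with
    | zero => exact .refl
    | succ n ih =>
      exact .tail (ih fun k hk => hn k (by omega))
        ((key _ _).2 ⟨hn n (by omega), (h n (hn n (by omega)) _).2 rfl⟩)

/-- A loop that decreases its counter by one in each round. -/
theorem trans_loop_count {i : ι} (u : ℕ → ℕ × (ι → ℕ)) (n : ℕ) (hu : ∀ k, (u k).2 i = n - k)
    (h : ∀ k < n,
      ∀ s', Trans P ((u k).1, Function.update (u k).2 i ((u k).2 i - 1)) s' ↔ s' = u (k + 1)) :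
    Trans (loop i P) (u 0) s' ↔ s' = u n := by
  rw [trans_loop u fun k hk => h k (by rw [hu] at hk; omega)]
  constructor
  · rintro ⟨m, h1, h2, rfl⟩
    rw [hu] at h2
    rcases Nat.lt_or_ge n m with h3 | h3
    · exact absurd (hu n) (by simpa using h1 n h3)
    · rw [show m = n by omega]
  · rintro rfl
    exact ⟨n, fun k hk => by rw [hu]; omega, by simp [hu], rfl⟩

theorem trans_inc (i : ι) :
    Trans (char (.inc i)) s s' ↔ s' = (s.1, Function.update s.2 i (s.2 i + 1)) :=
  trans_char _

end

/-! #### Macros on counters indexed by natural numbers -/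

section
variable {c : ℕ} {v : ℕ → ℕ} {s' : ℕ × (ℕ → ℕ)}

/-- Set the counter `i` to zero. -/
def clear (i : ℕ) : RegularExpression (Op ℕ) := loop i 1

theorem trans_clear (i : ℕ) : Trans (clear i) (c, v) s' ↔ s' = (c, Function.update v i 0) := by
  have h := trans_loop_count (P := 1) (i := i) (s' := s')
    (fun k => (c, Function.update v i (v i - k))) (v i) (by simp) fun k _ s' => by
      rw [trans_one]
      simp only [Function.update_self]
      constructor <;> rintro rfl <;> ext j <;> grind [Function.update_apply]
  simpa [clear] using h

/-- Add the counter `i` to the counters `j` and `k`, and set it to zero. -/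
def spread (i j k : ℕ) : RegularExpression (Op ℕ) := loop i (char (.inc j) * char (.inc k))

theorem trans_spread {i j k : ℕ} (hij : i ≠ j) (hik : i ≠ k) (hjk : j ≠ k) :
    Trans (spread i j k) (c, v) s' ↔
      s' = (c, Function.update (Function.update (Function.update v j (v j + v i)) k (v k + v i))
        i 0) := by
  have h := trans_loop_count (P := char (.inc j) * char (.inc k)) (i := i) (s' := s')
    -- The state after `m` rounds.
    (fun m => (c, Function.update (Function.update (Function.update v j (v j + m)) k (v k + m))
      i (v i - m))) (v i) (by simp) fun m _ s' => by
      rw [trans_mul_of_det fun _ => trans_inc j, trans_inc]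
      constructor <;> rintro rfl <;> ext l <;> grind [Function.update_apply]
  simpa [spread] using h

/-- Add the counter `i` to the counter `j`, and set it to zero. -/
def move (i j : ℕ) : RegularExpression (Op ℕ) := loop i (char (.inc j))

theorem trans_move {i j : ℕ} (hij : i ≠ j) :
    Trans (move i j) (c, v) s' ↔
      s' = (c, Function.update (Function.update v j (v j + v i)) i 0) := by
  have h := trans_loop_count (P := char (.inc j)) (i := i) (s' := s')
    (fun m => (c, Function.update (Function.update v j (v j + m)) i (v i - m)))
    (v i) (by simp) fun m _ s' => by
      rw [trans_inc]
      constructor <;> rintro rfl <;> ext l <;> grind [Function.update_apply]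
  simpa [move] using h

/-- Copy the counter `i` to the counter `o`, using the counters `b` and `b + 1`. -/
def copy (i o b : ℕ) : RegularExpression (Op ℕ) :=
  spread i b (b + 1) * (move b i * (clear o * move (b + 1) o))

/-- Reading a counter destroys it, so two copies are made and one restores the source. As `o` is
cleared only afterwards, `i = o` is allowed. -/
theorem trans_copy {i o b : ℕ} (hi : i < b) (ho : o < b) (hv : ∀ j ≥ b, v j = 0) :
    Trans (copy i o b) (c, v) s' ↔ s' = (c, Function.update v o (v i)) := by
  have h1 := hv b le_rfl
  have h2 := hv (b + 1) (by omega)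
  rw [copy, trans_mul_of_det fun _ => trans_spread (by omega) (by omega) (by omega),
    trans_mul_of_det fun _ => trans_move (by omega), trans_mul_of_det fun _ => trans_clear _,
    trans_move (by omega)]
  refine Eq.congr_right (Prod.ext rfl (funext fun j => ?_))
  have := hv j
  grind [Function.update_apply]

end
end DynComplexity

/-! ### Partial recursive functions on counters -/

namespace DynComplexity

open RegularExpression

theorem mem_vector_mOfFn {α : Type} : ∀ {n : ℕ} (g : Fin n → Part α) (x : List.Vector α n),
    x ∈ List.Vector.mOfFn g ↔ ∀ i, x.get i ∈ g i
  | 0, g, x => by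
    simp only [List.Vector.mOfFn, IsEmpty.forall_iff, iff_true]
    exact Part.mem_some_iff.2 (List.Vector.eq_nil x)
  | n + 1, g, x => by
    simp only [List.Vector.mOfFn, bind, Part.mem_bind_iff, mem_vector_mOfFn, pure]
    constructor
    · rintro ⟨y, hy, z, hz, hx⟩ i
      rw [Part.mem_some_iff.1 hx]
      refine Fin.cases ?_ (fun i => ?_) i
      · simpa using hy
      · simpa using hz i
    · intro h
      refine ⟨x.head, by simpa using h 0, x.tail, fun i => ?_, ?_⟩
      · simpa using h i.succ
      · simp

/-- For all argument counters, result counter and bound on the counters in use, some regular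
expression computes `f` and leaves all other counters unchanged. -/
def Implementable {n : ℕ} (f : List.Vector ℕ n →. ℕ) : Prop :=
  ∀ (a : Fin n → ℕ) (o b : ℕ), (∀ i, a i < b) → o < b →
    ∃ P : RegularExpression (Op ℕ), ∀ (c : ℕ) (v : ℕ → ℕ) (s' : ℕ × (ℕ → ℕ)),
      (∀ j ≥ b, v j = 0) → (Trans P (c, v) s' ↔
        ∃ y ∈ f (List.Vector.ofFn fun i => v (a i)), s' = (c, Function.update v o y))

/-- Set `k` counters from `b` on to zero. -/
def clearRange (b : ℕ) : ℕ → RegularExpression (Op ℕ)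
  | 0 => 1
  | k + 1 => clearRange b k * clear (b + k)

theorem trans_clearRange {c : ℕ} {v : ℕ → ℕ} (b k : ℕ) : ∀ s' : ℕ × (ℕ → ℕ),
    Trans (clearRange b k) (c, v) s' ↔
      s' = (c, fun j => if b ≤ j ∧ j < b + k then 0 else v j) := by
  induction k with
  | zero =>
    intro s'
    rw [clearRange, trans_one]
    refine Eq.congr_right (Prod.ext rfl (funext fun j => ?_))
    grind
  | succ k ih =>
    intro s'
    rw [clearRange, trans_mul_of_det ih, trans_clear]
    refine Eq.congr_right (Prod.ext rfl (funext fun j => ?_))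
    grind [Function.update_apply]

theorem implementable_zero : Implementable (n := 0) fun _ => Part.some 0 := by
  intro a o b _ _
  refine ⟨clear o, fun c v s' _ => ?_⟩
  simp [trans_clear]

theorem implementable_get {n : ℕ} (i : Fin n) :
    Implementable fun v : List.Vector ℕ n => Part.some (v.get i) := by
  intro a o b ha ho
  refine ⟨copy (a i) o b, fun c v s' hv => ?_⟩
  simp [trans_copy (ha i) ho hv]

theorem implementable_succ :
    Implementable fun v : List.Vector ℕ 1 => Part.some (v.head + 1) := by
  intro a o b ha ho
  refine ⟨copy (a 0) o b * char (.inc o), fun c v s' hv => ?_⟩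
  rw [trans_mul_of_det fun _ => trans_copy (ha 0) ho hv, trans_inc]
  simp [List.Vector.ofFn]

/-- The values of the inner functions go to the counters `b, …, b + n - 1`, with all scratch space
from `b + n` on; then `f` reads them, and they are cleared. An undefined argument leaves no outcome,
which agrees with the partial composition. -/
theorem Implementable.comp {m n : ℕ} {f : List.Vector ℕ n →. ℕ}
    {g : Fin n → List.Vector ℕ m →. ℕ} (hf : Implementable f) (hg : ∀ i, Implementable (g i)) :
    Implementable fun v => (List.Vector.mOfFn fun i => g i v) >>= f := by
  intro a o b ha ho
  -- Induction on the number of arguments computed so far. Only the values of `z` below `k` matter.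
  have hargs : ∀ k ≤ n, ∃ P : RegularExpression (Op ℕ), ∀ (c : ℕ) (v : ℕ → ℕ)
      (s' : ℕ × (ℕ → ℕ)), (∀ j ≥ b, v j = 0) → (Trans P (c, v) s' ↔
        ∃ z : ℕ → ℕ, (∀ i : Fin n, i < k → z i ∈ g i (List.Vector.ofFn fun i => v (a i))) ∧
          s' = (c, fun j => if b ≤ j ∧ j < b + k then z (j - b) else v j)) := by
    intro k hk
    induction k with
    | zero =>
      refine ⟨1, fun c v s' _ => ?_⟩
      rw [trans_one]
      constructor
      · rintro rfl
        refine ⟨fun _ => 0, by simp, ?_⟩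
        ext j <;> grind
      · rintro ⟨z, -, rfl⟩
        ext j <;> grind
    | succ k ih =>
      obtain ⟨P, hP⟩ := ih (by omega)
      obtain ⟨R, hR⟩ := hg ⟨k, hk⟩ a (b + k) (b + n) (fun i => (ha i).trans_le (by omega))
        (by omega)
      refine ⟨P * R, fun c v s' hv => ?_⟩
      have hstep : ∀ z : ℕ → ℕ, Trans R (c, fun j => if b ≤ j ∧ j < b + k then z (j - b) else v j)
          s' ↔ ∃ y ∈ g ⟨k, hk⟩ (List.Vector.ofFn fun i => v (a i)), s' = (c, fun j =>
            if b ≤ j ∧ j < b + (k + 1) then Function.update z k y (j - b) else v j) := by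
        intro z
        rw [hR _ _ _ fun j hj => by grind]
        have h1 : ∀ i, (if b ≤ a i ∧ a i < b + k then z (a i - b) else v (a i)) = v (a i) :=
          fun i => if_neg fun h => absurd (ha i) (by omega)
        simp only [h1]
        refine exists_congr fun y => and_congr_right fun _ => Eq.congr_right ?_
        refine Prod.ext rfl (funext fun j => ?_)
        grind [Function.update_apply]
      simp only [trans_mul, hP c v _ hv]
      constructor
      · rintro ⟨_, ⟨z, hz, rfl⟩, h⟩
        obtain ⟨y, hy, rfl⟩ := (hstep z).1 h
        refine ⟨Function.update z k y, fun i hi => ?_, rfl⟩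
        rcases eq_or_ne (i : ℕ) k with h | h
        · obtain rfl : i = ⟨k, hk⟩ := Fin.ext h
          simpa using hy
        · rw [Function.update_of_ne h]
          exact hz i (by omega)
      · rintro ⟨z, hz, rfl⟩
        refine ⟨_, ⟨z, fun i hi => hz i (by omega), rfl⟩, (hstep z).2 ⟨z k, hz ⟨k, hk⟩ (by simp), ?_⟩⟩
        simp
  obtain ⟨P, hP⟩ := hargs n le_rfl
  obtain ⟨R, hR⟩ := hf (fun i => b + i) o (b + n) (fun i => by omega) (by omega)
  refine ⟨P * (R * clearRange b n), fun c v s' hv => ?_⟩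
  have hstep : ∀ z : ℕ → ℕ, Trans (R * clearRange b n)
      (c, fun j => if b ≤ j ∧ j < b + n then z (j - b) else v j) s' ↔
        ∃ y ∈ f (List.Vector.ofFn fun i : Fin n => z i), s' = (c, Function.update v o y) := by
    intro z
    simp only [trans_mul]
    have h1 : ∀ t, _ := fun t => hR c (fun j => if b ≤ j ∧ j < b + n then z (j - b) else v j) t
      fun j hj => by grind
    have h2 : ∀ i : Fin n, (if b ≤ b + (i : ℕ) ∧ b + (i : ℕ) < b + n then z (b + i - b)
        else v (b + i)) = z i := fun i => by simp
    simp only [h2] at h1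
    simp only [h1]
    have h3 : ∀ y, (fun j => if b ≤ j ∧ j < b + n then 0 else Function.update (fun j =>
        if b ≤ j ∧ j < b + n then z (j - b) else v j) o y j) = Function.update v o y := by
      intro y
      funext j
      grind [Function.update_apply]
    constructor
    · rintro ⟨_, ⟨y, hy, rfl⟩, h⟩
      exact ⟨y, hy, by rw [(trans_clearRange _ _ _).1 h, h3]⟩
    · rintro ⟨y, hy, rfl⟩
      exact ⟨_, ⟨y, hy, rfl⟩, (trans_clearRange _ _ _).2 (by rw [h3])⟩
  have hbind : ∀ y, y ∈ ((List.Vector.mOfFn fun i => g i (List.Vector.ofFn fun i => v (a i))) >>= f)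
      ↔ ∃ x, (∀ i, x.get i ∈ g i (List.Vector.ofFn fun i => v (a i))) ∧ y ∈ f x := fun y =>
    Part.mem_bind_iff.trans (by simp only [mem_vector_mOfFn])
  simp only [trans_mul (P := P), hP c v _ hv, hbind]
  constructor
  · rintro ⟨_, ⟨z, hz, rfl⟩, h⟩
    obtain ⟨y, hy, rfl⟩ := (hstep z).1 h
    exact ⟨y, ⟨_, fun i => by simpa using hz i i.2, hy⟩, rfl⟩
  · rintro ⟨y, ⟨x, hx, hy⟩, rfl⟩
    refine ⟨_, ⟨fun i => if h : i < n then x.get ⟨i, h⟩ else 0, fun i _ => ?_, rfl⟩,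
      (hstep fun i => if h : i < n then x.get ⟨i, h⟩ else 0).2 ⟨y, ?_, rfl⟩⟩
    · simpa using hx i
    · have : (List.Vector.ofFn fun i : Fin n => if h : (i : ℕ) < n then x.get ⟨i, h⟩ else 0) = x := by
        ext i; simp
      rwa [this]

/-- The counter `b` counts the remaining rounds down, `b + 1` counts the recursion index up, and `b
+ 2` holds the value of the recursion at that index. -/
theorem Implementable.prec {n : ℕ} {f : List.Vector ℕ n → ℕ} {g : List.Vector ℕ (n + 2) → ℕ}
    (hf : Implementable fun v => Part.some (f v)) (hg : Implementable fun v => Part.some (g v)) :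
    Implementable fun v : List.Vector ℕ (n + 1) => Part.some
      (v.head.rec (f v.tail) fun y IH => g (y ::ᵥ IH ::ᵥ v.tail) : ℕ) := by
  intro a o b ha ho
  obtain ⟨P, hP⟩ := hf (fun i => a i.succ) (b + 2) (b + 3)
    (fun i => (ha _).trans_le (by omega)) (by omega)
  obtain ⟨R, hR⟩ := hg (Fin.cons (b + 1) (Fin.cons (b + 2) fun i => a i.succ)) (b + 2) (b + 3)
    (by
      refine fun i => Fin.cases ?_ (fun i => Fin.cases ?_ (fun i => ?_) i) i
      · simp
      · simp
      · simpa using (ha i.succ).trans_le (by omega)) (by omega)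
  refine ⟨P * (copy (a 0) b (b + 3) * (loop b (R * char (.inc (b + 1))) *
    (copy (b + 2) o (b + 3) * clearRange b 3))), fun c v s' hv => ?_⟩
  simp only [Part.mem_some_iff, exists_eq_left] at hP hR ⊢
  have ha0 := ha 0
  obtain ⟨x, hx⟩ : ∃ x, x = List.Vector.ofFn fun i => v (a i.succ) := ⟨_, rfl⟩
  have hx' : (List.Vector.ofFn fun i => v (a i)) = v (a 0) ::ᵥ x := hx ▸ rfl
  rw [hx', List.Vector.head_cons, List.Vector.tail_cons]
  obtain ⟨F, hF⟩ : ∃ F : ℕ → ℕ, ∀ k, F k = k.rec (f x) fun y IH => g (y ::ᵥ IH ::ᵥ x) :=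
    ⟨_, fun _ => rfl⟩
  rw [← hF]
  have hF0 : F 0 = f x := hF 0
  have hFs : ∀ k, F (k + 1) = g (k ::ᵥ F k ::ᵥ x) := fun k => by rw [hF, hF]
  have hloop := fun s' => trans_loop_count (P := R * char (.inc (b + 1))) (i := b) (s' := s')
    (fun k => (c, Function.update (Function.update (Function.update v (b + 2) (F k)) (b + 1) k)
      b (v (a 0) - k))) (v (a 0)) (by simp) fun k hk s' => by
      rw [trans_mul_of_det fun s' => hR _ _ s' fun j hj => by grind [Function.update_apply],
        trans_inc]
      have hargs : (List.Vector.ofFn fun i => Function.update (Function.update (Function.update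
          (Function.update v (b + 2) (F k)) (b + 1) k) b (v (a 0) - k)) b (v (a 0) - k - 1)
          (Fin.cons (α := fun _ => ℕ) (b + 1) (Fin.cons (α := fun _ => ℕ) (b + 2)
            fun i => a i.succ) i)) = k ::ᵥ F k ::ᵥ x := by
        rw [hx]
        simp only [List.Vector.ofFn, Fin.cons_zero, Fin.cons_succ]
        congr 1
        · grind [Function.update_apply]
        · congr 1
          · grind [Function.update_apply]
          · congr 1
            funext i
            have := ha i.succ
            grind [Function.update_apply]
      simp only [Function.update_self]
      rw [hargs, ← hFs]
      refine Eq.congr_right (Prod.ext rfl (funext fun j => ?_))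
      grind [Function.update_apply]
  have h0 : Function.update (Function.update v (b + 2) (f x)) b
      (Function.update v (b + 2) (f x) (a 0)) = Function.update (Function.update (Function.update v
        (b + 2) (F 0)) (b + 1) 0) b (v (a 0) - 0) := by
    have := hv (b + 1) (by omega)
    funext j
    grind [Function.update_apply]
  rw [trans_mul_of_det fun s' => hP c v s' fun j hj => hv j (by omega), ← hx,
    trans_mul_of_det fun s' => trans_copy (by omega) (by omega)
      fun j hj => by grind [Function.update_apply], h0,
    trans_mul_of_det hloop,
    trans_mul_of_det fun s' => trans_copy (by omega) (by omega)
      fun j hj => by grind [Function.update_apply], trans_clearRange]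
  refine Eq.congr_right (Prod.ext rfl (funext fun j => ?_))
  have := hv j
  grind [Function.update_apply]

/-- The counter `b` holds the candidate and `b + 1` the value of `f` there, which also controls the
loop. If no candidate gives zero, the loop has no outcome, just as the search is undefined. -/
theorem Implementable.rfind {n : ℕ} {f : List.Vector ℕ (n + 1) → ℕ}
    (hf : Implementable fun v => Part.some (f v)) :
    Implementable fun v => Nat.rfind fun n => Part.some (decide (f (n ::ᵥ v) = 0)) := by
  intro a o b ha ho
  obtain ⟨R, hR⟩ := hf (Fin.cons b a) (b + 1) (b + 2)
    (by
      refine fun i => Fin.cases ?_ (fun i => ?_) i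
      · simp
      · simpa using (ha i).trans_le (by omega)) (by omega)
  refine ⟨R * (loop (b + 1) (clear (b + 1) * (char (.inc b) * R)) *
    (copy b o (b + 2) * clearRange b 2)), fun c v s' hv => ?_⟩
  simp only [Part.mem_some_iff, exists_eq_left] at hR
  obtain ⟨x, hx⟩ : ∃ x, x = List.Vector.ofFn fun i => v (a i) := ⟨_, rfl⟩
  rw [← hx]
  -- The state on reaching candidate `k`; its counter `b + 1` need not decrease from round to round,
  -- so the general loop rule is required.
  let u : ℕ → ℕ × (ℕ → ℕ) := fun k =>
    (c, Function.update (Function.update v b k) (b + 1) (f (k ::ᵥ x)))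
  have hR' : ∀ k s', Trans R (c, Function.update v b k) s' ↔ s' = u k := by
    intro k s'
    rw [hR _ _ s' fun j hj => by grind [Function.update_apply]]
    have hargs : (List.Vector.ofFn fun i => Function.update v b k
        (Fin.cons (α := fun _ => ℕ) b a i)) = k ::ᵥ x := by
      rw [hx]
      simp only [List.Vector.ofFn, Fin.cons_zero, Fin.cons_succ]
      congr 1
      · simp
      · congr 1
        funext i
        have := ha i
        grind [Function.update_apply]
    rw [hargs]
  have hloop := fun s' => trans_loop (P := clear (b + 1) * (char (.inc b) * R)) (i := b + 1)
    (s' := s') u fun k _ s' => by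
      rw [trans_mul_of_det fun _ => trans_clear _, trans_mul_of_det fun _ => trans_inc _,
        ← hR' (k + 1)]
      have h0 := hv (b + 1) (by omega)
      have : Function.update v b (k + 1) = Function.update (Function.update (Function.update (u k).2
          (b + 1) ((u k).2 (b + 1) - 1)) (b + 1) 0) b (Function.update (Function.update (u k).2
          (b + 1) ((u k).2 (b + 1) - 1)) (b + 1) 0 b + 1) := by
        funext j
        grind [Function.update_apply]
      rw [this]
  have h0 : Function.update v b 0 = v := by
    rw [← hv b le_rfl, Function.update_eq_self]
  have h1 := hR' 0
  rw [h0] at h1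
  have hfin : ∀ n s', Trans (copy b o (b + 2) * clearRange b 2) (u n) s' ↔
      s' = (c, Function.update v o n) := by
    intro n s'
    rw [trans_mul_of_det fun s' => trans_copy (by omega) (by omega)
      fun j hj => by grind [Function.update_apply], trans_clearRange]
    refine Eq.congr_right (Prod.ext rfl (funext fun j => ?_))
    have := hv j
    grind [Function.update_apply]
  have hu : ∀ k, (u k).2 (b + 1) = f (k ::ᵥ x) := fun k => by simp [u]
  rw [trans_mul_of_det h1, trans_mul]
  simp only [hloop, hu]
  constructor
  · rintro ⟨_, ⟨n, hn, hn0, rfl⟩, h⟩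
    refine ⟨n, Nat.mem_rfind.2 ⟨by simp [hn0], fun {m} hm => by simp [hn m hm]⟩, (hfin _ _).1 h⟩
  · rintro ⟨n, hn, rfl⟩
    obtain ⟨h1, h2⟩ := Nat.mem_rfind.1 hn
    refine ⟨_, ⟨n, fun k hk => ?_, by simpa using h1, rfl⟩, (hfin _ _).2 rfl⟩
    simpa using h2 hk

theorem implementable_of_primrec {n : ℕ} {f : List.Vector ℕ n → ℕ} (hf : Nat.Primrec' f) :
    Implementable fun v => Part.some (f v) := by
  induction hf with
  | zero => exact implementable_zero
  | succ => exact implementable_succ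
  | get i => exact implementable_get i
  | comp g _ _ hf hg =>
    have := hf.comp hg
    simpa [Vector.mOfFn_part_some] using this
  | prec _ _ hf hg => exact hf.prec hg

/-- Partial recursive functions are computed by counter programs. -/
theorem implementable_of_partrec {n : ℕ} {f : List.Vector ℕ n →. ℕ} (hf : Nat.Partrec' f) :
    Implementable f := by
  induction hf with
  | prim hf => exact implementable_of_primrec hf
  | comp g _ _ hf hg => exact hf.comp hg
  | rfind _ hf => exact hf.rfind

end DynComplexity

/-! ### Finitely many counters, and an undecidable runnability problem -/

namespace DynComplexity

open RegularExpression

/-- Renaming of counters. -/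
def Op.map {ι κ : Type} (f : ι → κ) : Op ι → Op κ
  | inc i => inc (f i)
  | dec i => dec (f i)
  | zero i => zero (f i)
  | tick => tick
  | done => done

/-- Only counters below `k` are used. -/
def Op.Below (k : ℕ) : Op ℕ → Prop
  | inc i => i < k
  | dec i => i < k
  | zero i => i < k
  | tick => True
  | done => True

theorem Op.Below.mono {k l : ℕ} (hkl : k ≤ l) : ∀ {a : Op ℕ}, a.Below k → a.Below l
  | inc _, h => lt_of_lt_of_le (b := k) h hkl
  | dec _, h => lt_of_lt_of_le (b := k) h hkl
  | zero _, h => lt_of_lt_of_le (b := k) h hkl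
  | tick, _ => trivial
  | done, _ => trivial

theorem exists_below (P : RegularExpression (Op ℕ)) :
    ∃ k, ∀ w ∈ P.matches', ∀ a ∈ w, a.Below k := by
  induction P with
  | zero => exact ⟨0, fun _ h => h.elim⟩
  | epsilon =>
    refine ⟨0, fun w h => ?_⟩
    cases (show w = [] from h)
    simp
  | char a =>
    have : ∃ k, a.Below k := by
      cases a with
      | inc i => exact ⟨i + 1, Nat.lt_succ_self i⟩
      | dec i => exact ⟨i + 1, Nat.lt_succ_self i⟩
      | zero i => exact ⟨i + 1, Nat.lt_succ_self i⟩
      | tick => exact ⟨0, trivial⟩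
      | done => exact ⟨0, trivial⟩
    refine this.imp fun k hk w h => ?_
    cases (show w = [a] from h)
    simpa using hk
  | plus P Q hP hQ =>
    obtain ⟨k, hk⟩ := hP
    obtain ⟨l, hl⟩ := hQ
    refine ⟨max k l, fun w h a ha => ?_⟩
    rcases h with h | h
    · exact (hk w h a ha).mono (le_max_left k l)
    · exact (hl w h a ha).mono (le_max_right k l)
  | comp P Q hP hQ =>
    obtain ⟨k, hk⟩ := hP
    obtain ⟨l, hl⟩ := hQ
    refine ⟨max k l, ?_⟩
    rintro _ ⟨u, hu, v, hv, rfl⟩ a ha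
    rcases List.mem_append.1 ha with h | h
    · exact (hk u hu a h).mono (le_max_left k l)
    · exact (hl v hv a h).mono (le_max_right k l)
  | star P hP =>
    obtain ⟨k, hk⟩ := hP
    refine ⟨k, ?_⟩
    rintro _ ⟨l, rfl, hl⟩ a ha
    obtain ⟨w, hw, ha⟩ := List.mem_flatten.1 ha
    exact hk w (hl w hw) a ha

theorem step_map {k : ℕ} {f : ℕ → Fin k} (hf : ∀ i : Fin k, f i = i) {a : Op ℕ} (ha : a.Below k)
    (s : ℕ × (ℕ → ℕ)) (t : ℕ × (Fin k → ℕ)) :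
    (a.map f).Step (s.1, fun i => s.2 i) t ↔ ∃ s', a.Step s s' ∧ t = (s'.1, fun i : Fin k => s'.2 i) := by
  have hu : ∀ i (hi : i < k) (x : ℕ), Function.update (fun j : Fin k => s.2 j) (f i) x =
      fun j : Fin k => Function.update s.2 i x j := by
    intro i hi x
    funext j
    rw [hf ⟨i, hi⟩]
    simp [Function.update_apply, Fin.ext_iff]
  have hv : ∀ i (hi : i < k), (f i : ℕ) = i := fun i hi => by rw [hf ⟨i, hi⟩]
  cases a with
  | inc i => simp [Op.map, Op.Step, hu i ha, hv i ha]
  | dec i => simp [Op.map, Op.Step, hu i ha, hv i ha, and_assoc]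
  | zero i => simp [Op.map, Op.Step, hv i ha, and_assoc]
  | tick => simp [Op.map, Op.Step, and_assoc]
  | done => simp [Op.map, Op.Step, and_assoc]

theorem steps_map {k : ℕ} {f : ℕ → Fin k} (hf : ∀ i : Fin k, f i = i) {w : List (Op ℕ)} :
    ∀ (_ : ∀ a ∈ w, a.Below k) (s : ℕ × (ℕ → ℕ)) (t : ℕ × (Fin k → ℕ)),
      Steps (w.map (Op.map f)) (s.1, fun i => s.2 i) t ↔
        ∃ s', Steps w s s' ∧ t = (s'.1, fun i : Fin k => s'.2 i) := by
  induction w with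
  | nil => intro _ s t; simp [Steps]
  | cons a w ih =>
    intro hw s t
    simp only [List.map_cons, Steps, step_map hf (hw a (by simp))]
    have ih := ih fun b hb => hw b (by simp [hb])
    constructor
    · rintro ⟨_, ⟨s1, h1, rfl⟩, h2⟩
      obtain ⟨s2, h3, h4⟩ := (ih s1 t).1 h2
      exact ⟨s2, ⟨s1, h1, h3⟩, h4⟩
    · rintro ⟨s2, ⟨s1, h1, h3⟩, h4⟩
      exact ⟨_, ⟨s1, h1, rfl⟩, (ih s1 t).2 ⟨s2, h3, h4⟩⟩

/-- Some run of instructions with sequence in `L` is possible with countdown from `n` and all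
counters zero at the start. -/
def Runnable {ι : Type} [DecidableEq ι] (L : Language (Op ι)) (n : ℕ) : Prop :=
  ∃ w ∈ L, ∃ s', Steps w (n, fun _ => 0) s'

/-- A schema is finite, so counters must come from a finite type. A regular expression mentions only
finitely many of them, and renaming that fixes these preserves its runs. The proof takes one counter
more than needed, so that the type is nonempty. -/
theorem exists_runnable_fin (P : RegularExpression (Op ℕ)) :
    ∃ (k : ℕ) (R : RegularExpression (Op (Fin k))), ∀ n, Runnable R.matches' n ↔
      Runnable P.matches' n := by
  obtain ⟨k, hk⟩ := exists_below P
  refine ⟨k + 1, P.map (Op.map (Fin.ofNat (k + 1))), fun n => ?_⟩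
  have hf : ∀ i : Fin (k + 1), Fin.ofNat (k + 1) i = i := fun i => Fin.ofNat_val_eq_self i
  have key : ∀ w ∈ P.matches', (∃ t, Steps (w.map (Op.map (Fin.ofNat (k + 1)))) (n, fun _ => 0) t) ↔
      ∃ s', Steps w (n, fun _ => 0) s' := by
    intro w hw
    have := steps_map hf (fun a ha => (hk w hw a ha).mono (Nat.le_succ k)) (n, fun _ => 0)
    simp only [this]
    exact ⟨fun ⟨_, s', h, _⟩ => ⟨s', h⟩, fun ⟨s', h⟩ => ⟨_, s', h, rfl⟩⟩
  rw [Runnable, matches'_map]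
  constructor
  · rintro ⟨_, ⟨w, hw, rfl⟩, h⟩
    exact ⟨w, hw, (key w hw).1 h⟩
  · rintro ⟨w, hw, h⟩
    exact ⟨_, ⟨w, hw, rfl⟩, (key w hw).2 h⟩

/-- Transfer of the countdown to the counter `0`. -/
def fetch : RegularExpression (Op ℕ) := .star (char .tick * char (.inc 0)) * char .done

/-- The test for an exhausted countdown forces the star to make exactly `n` rounds. From then on the
input is an ordinary counter. -/
theorem trans_fetch (n : ℕ) (s' : ℕ × (ℕ → ℕ)) :
    Trans fetch (n, fun _ => 0) s' ↔ s' = (0, Function.update (fun _ => 0) 0 n) := by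
  have hstep : ∀ m k : ℕ, ∀ t, Trans (char .tick * char (.inc 0))
      (m, Function.update (fun _ => 0) 0 k) t ↔
        m ≠ 0 ∧ t = (m - 1, Function.update (fun _ => 0) 0 (k + 1)) := by
    intro m k t
    simp only [trans_mul, trans_char, Op.Step]
    constructor
    · rintro ⟨_, ⟨h, rfl⟩, rfl⟩
      exact ⟨h, by simp⟩
    · rintro ⟨h, rfl⟩
      exact ⟨_, ⟨h, rfl⟩, by simp⟩
  have hinit : (fun _ => 0 : ℕ → ℕ) = Function.update (fun _ => 0) 0 0 := by
    simp
  simp only [fetch, trans_mul (P := .star _), trans_star, trans_char, Op.Step]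
  constructor
  · rintro ⟨t, h, h0, rfl⟩
    have : ∃ k ≤ n, s' = (n - k, Function.update (fun _ => 0) 0 k) := by
      clear h0
      induction h with
      | refl => exact ⟨0, by simp, by rw [← hinit]; simp⟩
      | tail _ h ih =>
        obtain ⟨k, hk, rfl⟩ := ih
        obtain ⟨h1, rfl⟩ := (hstep _ _ _).1 h
        exact ⟨k + 1, by omega, by simp [Nat.sub_sub]⟩
    obtain ⟨k, hk, rfl⟩ := this
    obtain rfl : k = n := by simp only at h0; omega
    simp
  · rintro rfl
    refine ⟨_, ?_, rfl, rfl⟩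
    have : ∀ k ≤ n, Relation.ReflTransGen (Trans (char .tick * char (.inc 0))) (n, fun _ => 0)
        (n - k, Function.update (fun _ => 0) 0 k) := by
      intro k hk
      induction k with
      | zero => rw [← hinit]; exact .refl
      | succ k ih =>
        refine .tail (ih (by omega)) ((hstep _ _ _).2 ⟨by omega, by simp [Nat.sub_sub]⟩)
    simpa using this n le_rfl

/-- Runnability is undecidable for some regular language of instructions. -/
theorem exists_not_computablePred_runnable : ∃ (k : ℕ) (R : RegularExpression (Op (Fin k))),
    ¬ ComputablePred (Runnable R.matches') := by
  let f : ℕ →. ℕ := fun n => (Denumerable.ofNat Nat.Partrec.Code n).eval 0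
  have hf : Partrec f := Nat.Partrec.Code.eval_part.comp (Computable.ofNat _) (Computable.const 0)
  -- The argument is counter `0`, where `fetch` leaves it, the result is counter `1`, and scratch
  -- space starts at `2`.
  obtain ⟨P, hP⟩ := implementable_of_partrec (Nat.Partrec'.part_iff₁.2 hf) (fun _ => 0) 1 2
    (by simp) (by simp)
  obtain ⟨k, R, hR⟩ := exists_runnable_fin (fetch * P)
  refine ⟨k, R, fun h => ComputablePred.halting_problem 0 ?_⟩
  have hdom : ∀ n, Runnable (fetch * P).matches' n ↔ (f n).Dom := by
    intro n
    have h1 : Runnable (fetch * P).matches' n ↔ ∃ s', Trans (fetch * P) (n, fun _ => 0) s' :=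
      ⟨fun ⟨w, hw, s', h⟩ => ⟨s', w, hw, h⟩, fun ⟨s', w, hw, h⟩ => ⟨w, hw, s', h⟩⟩
    have h2 := fun s' => hP 0 (Function.update (fun _ => 0) 0 n) s' fun j hj => by
      rw [Function.update_of_ne (by omega)]
    have h3 : (List.Vector.ofFn fun _ : Fin 1 => Function.update (fun _ => 0 : ℕ → ℕ) 0 n 0).head
        = n := by simp [List.Vector.ofFn]
    rw [h1]
    simp only [trans_mul_of_det (trans_fetch n), h2, h3]
    exact ⟨fun ⟨_, y, hy, _⟩ => Part.dom_iff_mem.2 ⟨y, hy⟩,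
      fun h => (Part.dom_iff_mem.1 h).elim fun y hy => ⟨_, y, hy, rfl⟩⟩
  obtain ⟨hd, hc⟩ := h
  refine ⟨fun c => decidable_of_iff (Runnable R.matches' (Encodable.encode c)) ?_,
    (hc.comp Computable.encode).of_eq fun c => ?_⟩
  · rw [hR, hdom]
    simp [f]
  · congr 1
    rw [hR, hdom]
    simp [f]

end DynComplexity

namespace DynComplexity

open RegularExpression

/-! ### Simulation of counter programs by gadgets -/

namespace RawMod

variable {p : ℕ} {S D : Type} (I : S → Set (Fin p → D)) (x : S) (t : Fin p → D)

theorem apply_ins_self : (⟨.ins, x, t⟩ : RawMod p S D).apply I x = insert t (I x) := by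
  simp [apply]

theorem apply_del_self : (⟨.del, x, t⟩ : RawMod p S D).apply I x = I x \ {t} := by
  simp [apply]

theorem apply_of_ne {δ : RawMod p S D} {x : S} (h : x ≠ δ.symbol) : δ.apply I x = I x := by
  obtain ⟨k, z, t⟩ := δ
  cases k <;> simp_all [apply]

theorem mem_apply (δ : RawMod p S D) :
    t ∈ δ.apply I x ↔ (δ.kind = .ins ∧ x = δ.symbol ∧ t = δ.tuple) ∨
      (t ∈ I x ∧ ¬ (δ.kind = .del ∧ x = δ.symbol ∧ t = δ.tuple)) := by
  obtain ⟨k, z, u⟩ := δ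
  cases k <;> simp only [apply, Function.update_apply] <;> split_ifs with h <;> simp [h]

end RawMod

namespace Gadget

variable {p r : ℕ} {S A Λ D : Type} (G : Gadget p r S A Λ)

/-- The modification that performs an action with a given tuple. -/
def mod (a : Λ) (t : Fin p → D) : RawMod p S D := ⟨G.kind a, G.symbol a, t⟩

theorem match_nil {y : Fin r → D} {s : RawState p r S A D} {α : List (RawMod p S D)} :
    G.Match y s [] α ↔ α = [] := by
  cases α <;> simp [Match]

theorem match_cons {y : Fin r → D} {s : RawState p r S A D} {a : Λ} {w : List Λ}
    {α : List (RawMod p S D)} : G.Match y s (a :: w) α ↔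
      ∃ t β, α = G.mod a t :: β ∧ (G.guard a).Eval s.inp s.aux s.count (Sum.elim t y) ∧
        G.Match y (G.step s (G.mod a t)) w β := by
  constructor
  · intro h
    match α, h with
    | ⟨k, x, t⟩ :: β, ⟨h1, h2, h3, h4⟩ =>
      simp only at h1 h2
      subst h1 h2
      exact ⟨t, β, rfl, h3, h4⟩
  · rintro ⟨t, β, rfl, h1, h2⟩
    exact ⟨rfl, rfl, h1, h2⟩

theorem match_append {y : Fin r → D} {u w : List Λ} : ∀ {s : RawState p r S A D}
    {α : List (RawMod p S D)}, G.Match y s (u ++ w) α ↔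
      ∃ β γ, α = β ++ γ ∧ G.Match y s u β ∧ G.Match y (G.run s β) w γ := by
  induction u with
  | nil => intro s α; simp [match_nil, RawProgram.run]
  | cons a u ih =>
    intro s α
    simp only [List.cons_append, match_cons, ih]
    constructor
    · rintro ⟨t, _, rfl, h, β, γ, rfl, h1, h2⟩
      exact ⟨_ :: β, γ, rfl, ⟨t, β, rfl, h, h1⟩, h2⟩
    · rintro ⟨_, γ, rfl, ⟨t, β, rfl, h, h1⟩, h2⟩
      exact ⟨t, _, rfl, h, β, γ, rfl, h1, h2⟩

/-- An invariant that relates states of a gadget to configurations of counter programs, when the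
gadget starts with the actions `setup` and then performs the instruction `a` by the actions `h a`.-/
structure Simulation (k : ℕ) where
  h : Op (Fin k) → List Λ
  setup : List Λ
  Inv : {D : Type} → RawState p r S A D → ℕ × (Fin k → ℕ) → Prop
  inv_setup : ∀ {D : Type} [Finite D] (y : Fin r → D) (n : ℕ) (α : List (RawMod p S D)),
    G.Match y (G.start n D) setup α → Inv (G.run (G.start n D) α) (n, fun _ => 0)
  exists_setup : ∀ {D : Type} [Finite D] [Nonempty D] (y : Fin r → D) (n : ℕ),
    ∃ α : List (RawMod p S D), G.Match y (G.start n D) setup α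
  sound : ∀ {D : Type} [Finite D] (y : Fin r → D) (s : RawState p r S A D) (x : ℕ × (Fin k → ℕ))
    (a : Op (Fin k)) (α : List (RawMod p S D)), Inv s x → G.Match y s (h a) α →
      ∃ x', a.Step x x' ∧ Inv (G.run s α) x'
  complete : ∀ {D : Type} [Finite D] [Nonempty D] (y : Fin r → D) (s : RawState p r S A D)
    (x x' : ℕ × (Fin k → ℕ)) (a : Op (Fin k)), Inv s x → a.Step x x' →
      (∀ i, x.2 i + 1 < Nat.card D) → ∃ α, G.Match y s (h a) α

namespace Simulation

variable {G} {k : ℕ} (σ : G.Simulation k)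

/-- The sequences of actions that simulate the sequences of instructions in a language. -/
noncomputable def image (R : RegularExpression (Op (Fin k))) : RegularExpression Λ :=
  σ.setup.foldr (fun a P => char a * P) 1 * R.subst σ.h

theorem mem_image (R : RegularExpression (Op (Fin k))) (x : List Λ) :
    x ∈ (σ.image R).matches' ↔ ∃ w ∈ R.matches', x = σ.setup ++ w.flatMap σ.h := by
  rw [image, matches'_mul, matches'_foldr_char, Language.mem_mul]
  simp only [mem_matches'_subst]
  constructor
  · rintro ⟨_, rfl, _, ⟨w, hw, rfl⟩, rfl⟩
    exact ⟨w, hw, rfl⟩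
  · rintro ⟨w, hw, rfl⟩
    exact ⟨_, rfl, _, ⟨w, hw, rfl⟩, rfl⟩

theorem steps_of_match [Finite D] {y : Fin r → D} {w : List (Op (Fin k))} :
    ∀ {s : RawState p r S A D} {x : ℕ × (Fin k → ℕ)} {α : List (RawMod p S D)}, σ.Inv s x →
      G.Match y s (w.flatMap σ.h) α → ∃ x', Steps w x x' := by
  induction w with
  | nil => exact fun {_ x _} _ _ => ⟨x, rfl⟩
  | cons a w ih =>
    intro s x α hs hα
    rw [List.flatMap_cons, match_append] at hα
    obtain ⟨β, γ, rfl, h1, h2⟩ := hα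
    obtain ⟨x', h3, h4⟩ := σ.sound y s x a β hs h1
    obtain ⟨x'', h5⟩ := ih h4 h2
    exact ⟨x'', x', h3, h5⟩

theorem _root_.DynComplexity.Op.Step.det {ι : Type} [DecidableEq ι] {a : Op ι}
    {x x' x'' : ℕ × (ι → ℕ)} (h1 : a.Step x x') (h2 : a.Step x x'') : x' = x'' := by
  cases a <;> simp_all [Op.Step]

theorem _root_.DynComplexity.Op.Step.le {ι : Type} [DecidableEq ι] {a : Op ι}
    {x x' : ℕ × (ι → ℕ)} (h : a.Step x x') (i : ι) : x'.2 i ≤ x.2 i + 1 := by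
  cases a with
  | inc j => obtain rfl := h; simp only [Function.update_apply]; split_ifs with h <;> simp [h]
  | dec j =>
    obtain ⟨_, rfl⟩ := h
    simp only [Function.update_apply]
    split_ifs with h
    · subst h; omega
    · omega
  | zero j => obtain ⟨_, rfl⟩ := h; omega
  | tick => obtain ⟨_, rfl⟩ := h; simp
  | done => obtain ⟨_, rfl⟩ := h; omega

/-- An instruction increases each counter by at most one, so the room required for all remaining
instructions is still there after each of them. -/
theorem match_of_steps [Finite D] [Nonempty D] {y : Fin r → D} {w : List (Op (Fin k))} :
    ∀ {s : RawState p r S A D} {x x' : ℕ × (Fin k → ℕ)}, σ.Inv s x → Steps w x x' →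
      (∀ i, x.2 i + w.length < Nat.card D) → ∃ α, G.Match y s (w.flatMap σ.h) α := by
  induction w with
  | nil => exact fun _ _ _ => ⟨[], trivial⟩
  | cons a w ih =>
    rintro s x x'' hs ⟨x', h1, h2⟩ hx
    simp only [List.length_cons] at hx
    obtain ⟨α, hα⟩ := σ.complete y s x x' a hs h1 fun i => by have := hx i; omega
    -- The new state of the gadget represents some successor configuration by soundness, and this is
    -- `x'` because instructions are deterministic.
    obtain ⟨z, h3, h4⟩ := σ.sound y s x a α hs hα
    obtain rfl := h1.det h3
    obtain ⟨β, hβ⟩ := ih h4 h2 fun i => by have := hx i; have := h1.le i; omega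
    exact ⟨α ++ β, by rw [List.flatMap_cons, match_append]; exact ⟨α, β, rfl, hα, hβ⟩⟩

theorem feasible_iff (R : RegularExpression (Op (Fin k))) (n : ℕ) :
    G.Feasible (σ.image R).matches' n ↔ Runnable R.matches' n := by
  constructor
  · rintro ⟨D, _, y, x, α, _, hx, hα⟩
    obtain ⟨w, hw, rfl⟩ := (σ.mem_image R x).1 hx
    obtain ⟨β, γ, rfl, h1, h2⟩ := (G.match_append).1 hα
    exact ⟨w, hw, σ.steps_of_match (σ.inv_setup y n β h1) h2⟩
  · rintro ⟨w, hw, x', h⟩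
    -- Counters start at zero, so the bound to be met is `w.length < Nat.card D`.
    let D := Fin (w.length + 1)
    let y : Fin r → D := fun _ => 0
    obtain ⟨β, hβ⟩ := σ.exists_setup y n
    obtain ⟨γ, hγ⟩ := σ.match_of_steps (y := y) (σ.inv_setup y n β hβ) h (by simp [D])
    exact ⟨D, inferInstance, y, _, β ++ γ, inferInstance, (σ.mem_image R _).2 ⟨w, hw, rfl⟩,
      (G.match_append).2 ⟨β, γ, rfl, hβ, hγ⟩⟩

theorem not_computablePred_feasible {R : RegularExpression (Op (Fin k))}
    (hR : ¬ ComputablePred (Runnable R.matches')) :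
    ¬ ComputablePred (G.Feasible (σ.image R).matches') :=
  fun h => hR (h.of_eq (σ.feasible_iff R))

end Simulation

/-- A simulation with one action per instruction. -/
@[simps] def Simulation.ofDirect {k : ℕ} (G : Gadget p r S A (Op (Fin k)))
    (Inv : {D : Type} → RawState p r S A D → ℕ × (Fin k → ℕ) → Prop)
    (inv_start : ∀ {D : Type} (n : ℕ), Inv (G.start n D) (n, fun _ => 0))
    (sound : ∀ {D : Type} [Finite D] (y : Fin r → D) (s : RawState p r S A D)
      (x : ℕ × (Fin k → ℕ)) (a : Op (Fin k)) (t : Fin p → D), Inv s x →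
        (G.guard a).Eval s.inp s.aux s.count (Sum.elim t y) →
          ∃ x', a.Step x x' ∧ Inv (G.step s (G.mod a t)) x')
    (complete : ∀ {D : Type} [Finite D] [Nonempty D] (y : Fin r → D) (s : RawState p r S A D)
      (x x' : ℕ × (Fin k → ℕ)) (a : Op (Fin k)), Inv s x → a.Step x x' →
        (∀ i, x.2 i + 1 < Nat.card D) →
          ∃ t, (G.guard a).Eval s.inp s.aux s.count (Sum.elim t y)) : G.Simulation k where
  h a := [a]
  setup := []
  Inv := Inv
  inv_setup y n α h := by
    rw [match_nil] at h
    subst h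
    exact inv_start n
  exists_setup y n := ⟨[], trivial⟩
  sound y s x a α hs h := by
    rw [match_cons] at h
    obtain ⟨t, β, rfl, h1, h2⟩ := h
    rw [match_nil] at h2
    subst h2
    exact sound y s x a t hs h1
  complete y s x x' a hs h hx := by
    obtain ⟨t, ht⟩ := complete y s x x' a hs h hx
    exact ⟨[G.mod a t], (G.match_cons).2 ⟨t, [], rfl, ht, trivial⟩⟩

end Gadget

/-! ### Counters as cardinalities of unary input relations -/

/-- Counters are the cardinalities of unary input relations; zero tests use a quantifier. -/
def cardGadget (k : ℕ) : Gadget 1 0 (Option (Fin k)) Empty (Op (Fin k)) where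
  tick := none
  update _ _ := nofun
  init := nofun
  kind
    | .inc _ => .ins
    | .dec _ => .del
    | .zero _ => .ins
    | .tick => .del
    | .done => .ins
  symbol
    | .inc i => some i
    | .dec i => some i
    | .zero _ => none
    | .tick => none
    | .done => none
  guard
    | .inc i => .not (.inp (some i) .inl)
    | .dec i => .inp (some i) .inl
    | .zero i => .not (.diag (some i))
    | .tick => .not .zero
    | .done => .zero

/-- The cardinalities of the input relations are the values of the counters. -/
def CardInv {k : ℕ} {D : Type} (s : RawState 1 0 (Option (Fin k)) Empty D)
    (x : ℕ × (Fin k → ℕ)) : Prop :=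
  s.count = x.1 ∧ ∀ i, (s.inp (some i)).ncard = x.2 i

/-- Guards make an insertion add a new element and a deletion remove a present one, so cardinalities
change by exactly one. The symbol `none` takes the modifications that stand for tests and ticks; its
content is irrelevant. -/
theorem cardInv_step {k : ℕ} {D : Type} [Finite D] {s : RawState 1 0 (Option (Fin k)) Empty D}
    {x : ℕ × (Fin k → ℕ)} {y : Fin 0 → D} {a : Op (Fin k)} {t : Fin 1 → D} (hs : CardInv s x)
    (ht : ((cardGadget k).guard a).Eval s.inp s.aux s.count (Sum.elim t y)) :
    ∃ x', a.Step x x' ∧ CardInv ((cardGadget k).step s ((cardGadget k).mod a t)) x' := by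
  obtain ⟨c, v⟩ := x
  obtain ⟨rfl, hv⟩ := hs
  simp only at hv
  cases a with
  | inc i =>
    have ht : t ∉ s.inp (some i) := ht
    refine ⟨_, rfl, ?_, fun j => ?_⟩
    · simp [RawProgram.step, Gadget.mod, cardGadget]
    · change ((RawMod.mk .ins (some i) t).apply s.inp (some j)).ncard = Function.update v i (v i + 1) j
      rcases eq_or_ne j i with rfl | hj
      · rw [RawMod.apply_ins_self, Function.update_self, ← hv j, Set.ncard_insert_of_notMem ht]
      · rw [RawMod.apply_of_ne _ (by simpa using hj), Function.update_of_ne hj, hv]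
  | dec i =>
    have ht : t ∈ s.inp (some i) := ht
    refine ⟨_, ⟨?_, rfl⟩, ?_, fun j => ?_⟩
    · change v i ≠ 0
      rw [← hv]
      exact ((Set.ncard_pos (Set.toFinite _)).2 ⟨t, ht⟩).ne'
    · simp [RawProgram.step, Gadget.mod, cardGadget]
    · change ((RawMod.mk .del (some i) t).apply s.inp (some j)).ncard = Function.update v i (v i - 1) j
      rcases eq_or_ne j i with rfl | hj
      · rw [RawMod.apply_del_self, Function.update_self, ← hv j, Set.ncard_sdiff_singleton_of_mem ht]
      · rw [RawMod.apply_of_ne _ (by simpa using hj), Function.update_of_ne hj, hv]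
  | zero i =>
    have ht : ¬ ∃ x : D, (fun _ => x) ∈ s.inp (some i) := ht
    refine ⟨_, ⟨?_, rfl⟩, ?_, fun j => ?_⟩
    · change v i = 0
      rw [← hv, Set.ncard_eq_zero, Set.eq_empty_iff_forall_notMem]
      intro t ht'
      exact ht ⟨t 0, by rwa [show (fun _ => t 0) = t by ext j; rw [Subsingleton.elim j 0]]⟩
    · simp [RawProgram.step, Gadget.mod, cardGadget]
    · change ((RawMod.mk .ins none t).apply s.inp (some j)).ncard = v j
      rw [RawMod.apply_of_ne _ (by simp), hv]
  | tick =>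
    have ht : ¬ s.count = 0 := ht
    refine ⟨_, ⟨ht, rfl⟩, ?_, fun j => ?_⟩
    · simp [RawProgram.step, Gadget.mod, cardGadget]
    · change ((RawMod.mk .del none t).apply s.inp (some j)).ncard = v j
      rw [RawMod.apply_of_ne _ (by simp), hv]
  | done =>
    have ht : s.count = 0 := ht
    refine ⟨_, ⟨ht, rfl⟩, ?_, fun j => ?_⟩
    · simp [RawProgram.step, Gadget.mod, cardGadget]
    · change ((RawMod.mk .ins none t).apply s.inp (some j)).ncard = v j
      rw [RawMod.apply_of_ne _ (by simp), hv]

/-- Simulation with cardinalities as counters. -/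
def cardSimulation (k : ℕ) : (cardGadget k).Simulation k :=
  .ofDirect (cardGadget k) CardInv
    (fun n => ⟨rfl, fun i => Set.ncard_empty _⟩)
    (fun y s x a t hs ht => cardInv_step hs ht)
    (fun {D} _ _ y s x x' a hs h hx => by
      obtain ⟨h1, h2⟩ := hs
      have d : D := Classical.arbitrary D
      cases a with
      | inc i =>
        -- If every insertion were refused, the relation would be full and the counter would equal
        -- the size of the domain.
        by_contra! hcon
        have : s.inp (some i) = Set.univ := Set.eq_univ_of_forall fun t => not_not.1 (hcon t)
        have h3 := h2 i
        rw [this, Set.ncard_univ, Nat.card_fun, Nat.card_fin, pow_one] at h3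
        have := hx i
        omega
      | dec i =>
        obtain ⟨t, ht⟩ := Set.nonempty_of_ncard_ne_zero ((h2 i).trans_ne h.1)
        exact ⟨t, ht⟩
      | zero i =>
        have h3 : s.inp (some i) = ∅ := (Set.ncard_eq_zero).1 ((h2 i).trans h.1)
        exact ⟨fun _ => d, fun ⟨z, hz⟩ => by rw [h3] at hz; exact hz⟩
      | tick => exact ⟨fun _ => d, fun h0 => h.1 (h1.symm.trans h0)⟩
      | done => exact ⟨fun _ => d, h1.trans h.1⟩)

theorem not_emptinessDecidable_dynFO_one_zero : ¬ EmptinessDecidable (DynFO 1 0) := by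
  obtain ⟨k, R, hR⟩ := exists_not_computablePred_runnable
  exact (cardGadget k).not_emptinessDecidable_dynFO ((cardSimulation k).image R).isRegular_matches'
    ((cardSimulation k).not_computablePred_feasible hR)

end DynComplexity

namespace DynComplexity

/-! ### Counters as stacks with binary auxiliary relations -/

/-- Auxiliary symbols for stacks. Only the first coordinate matters for `first` and `top`, and no
coordinate for `empty`. -/
inductive StackSym (ι : Type) : Type
  | empty (i : ι)
  | first (i : ι)
  | top (i : ι)
  | next (i : ι)
  deriving Fintype

/-- Quantifier-free updates on insertion of the variable `x` into the stack `i`. -/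
def pushUpdate {k : ℕ} (i : Fin k) :
    StackSym (Fin k) → Raw 1 2 (Option (Fin k)) (StackSym (Fin k))
  | .empty j => if j = i then .bot else .aux (.empty j) .inr
  | .first j => if j = i then
      .or (.and (.aux (.first j) .inr) (.not (.eq (.inr 0) (.inl 0))))
        (.and (.eq (.inr 0) (.inl 0)) (.aux (.empty j) .inr))
      else .aux (.first j) .inr
  | .top j => if j = i then .eq (.inr 0) (.inl 0) else .aux (.top j) .inr
  | .next j => if j = i then
      .or (.and (.aux (.next j) .inr) (.not (.eq (.inr 1) (.inl 0))))
        (.and (.eq (.inr 1) (.inl 0)) (.aux (.top j) .inr))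
      else .aux (.next j) .inr

/-- Quantifier-free updates on deletion of the variable `x` from the stack `i`. -/
def popUpdate {k : ℕ} (i : Fin k) :
    StackSym (Fin k) → Raw 1 2 (Option (Fin k)) (StackSym (Fin k))
  | .empty j => if j = i then .aux (.first j) fun _ => .inl 0 else .aux (.empty j) .inr
  | .first j => .aux (.first j) .inr
  | .top j => if j = i then .aux (.next j) ![.inr 0, .inl 0] else .aux (.top j) .inr
  | .next j => .aux (.next j) .inr

/-- Counters are stacks of elements of unary input relations, with quantifier-free updates. -/
def stackGadget (k : ℕ) : Gadget 1 2 (Option (Fin k)) (StackSym (Fin k)) (Op (Fin k)) where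
  tick := none
  update
    | .ins, some i, b => pushUpdate i b
    | .del, some i, b => popUpdate i b
    | _, none, b => .aux b .inr
  init
    | .empty _ => true
    | _ => false
  kind
    | .inc _ => .ins
    | .dec _ => .del
    | .zero _ => .ins
    | .tick => .del
    | .done => .ins
  symbol
    | .inc i => some i
    | .dec i => some i
    | .zero _ => none
    | .tick => none
    | .done => none
  guard
    | .inc i => .not (.inp (some i) .inl)
    | .dec i => .aux (.top i) fun _ => .inl 0
    | .zero i => .aux (.empty i) fun _ => .inl 0
    | .tick => .not .zero
    | .done => .zero

theorem qf_stackGadget (k : ℕ) : (stackGadget k).QF := by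
  constructor
  · rintro (_ | _) (_ | i) (j | j | j | j)
    all_goals first
      | exact trivial
      | (simp only [stackGadget, pushUpdate, popUpdate]; split_ifs <;> simp)
  · rintro (_ | _ | _ | _ | _) <;> simp [stackGadget]

/-- The relations represent the stack `l`, whose top is its head. -/
structure IsStack {D : Type} (I : Set (Fin 1 → D)) (E F T N : Set (Fin 2 → D)) (l : List D) :
    Prop where
  nodup : l.Nodup
  inp : ∀ t, t ∈ I ↔ t 0 ∈ l
  empty : ∀ y, y ∈ E ↔ l = []
  top : ∀ y, y ∈ T ↔ l.head? = some (y 0)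
  first : ∀ a m, a :: m <:+ l → ∀ y, y 0 = a → (y ∈ F ↔ m = [])
  next : ∀ a m, a :: m <:+ l → ∀ y, y 1 = a → (y ∈ N ↔ m.head? = some (y 0))

/-- An element pushed earlier and popped since may have left outdated tuples in `F` and `N`. They
are discarded and replaced by the present emptiness flag and the present top. Entries of elements on
the stack survive, because the pushed element is not among them. -/
theorem IsStack.push {D : Type} {I : Set (Fin 1 → D)} {E F T N : Set (Fin 2 → D)} {l : List D}
    (h : IsStack I E F T N l) {t : Fin 1 → D} (ht : t ∉ I) :
    IsStack (insert t I) ∅ {y | (y ∈ F ∧ ¬ y 0 = t 0) ∨ (y 0 = t 0 ∧ y ∈ E)} {y | y 0 = t 0}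
      {y | (y ∈ N ∧ ¬ y 1 = t 0) ∨ (y 1 = t 0 ∧ y ∈ T)} (t 0 :: l) := by
  have ht' : t 0 ∉ l := fun h' => ht ((h.inp t).2 h')
  refine ⟨List.nodup_cons.2 ⟨ht', h.nodup⟩, fun z => ?_, by simp, fun y => ?_, ?_, ?_⟩
  · have : z = t ↔ z 0 = t 0 :=
      ⟨fun h => h ▸ rfl, fun h => funext fun j => by rw [Subsingleton.elim j 0, h]⟩
    rw [Set.mem_insert_iff, h.inp, this, List.mem_cons]
  · simp [eq_comm]
  · intro a m ham y hy
    rcases List.suffix_cons_iff.1 ham with h1 | h1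
    · obtain ⟨rfl, rfl⟩ := List.cons.inj h1
      simp [hy, h.empty]
    · have ha : a ≠ t 0 := fun h' => ht' (h' ▸ h1.subset (by simp))
      simp [hy, ha, h.first a m h1 y hy]
  · intro a m ham y hy
    rcases List.suffix_cons_iff.1 ham with h1 | h1
    · obtain ⟨rfl, rfl⟩ := List.cons.inj h1
      simp [hy, h.top]
    · have ha : a ≠ t 0 := fun h' => ht' (h' ▸ h1.subset (by simp))
      simp [hy, ha, h.next a m h1 y hy]

/-- The popped element is a variable of the update, so `F` tells directly whether it was the last
and `N` which element lay below it; no quantifier searches for the new top. `F` and `N` may stay,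
since they are constrained only at elements of the stack. -/
theorem IsStack.pop {D : Type} {I : Set (Fin 1 → D)} {E F T N : Set (Fin 2 → D)} {l : List D}
    {t : Fin 1 → D} (h : IsStack I E F T N (t 0 :: l)) :
    IsStack (I \ {t}) {_y | (fun _ => t 0) ∈ F} F {y | ![y 0, t 0] ∈ N} N l := by
  obtain ⟨ht, hl⟩ := List.nodup_cons.1 h.nodup
  refine ⟨hl, fun z => ?_, fun y => ?_, fun y => ?_, fun a m ham => ?_, fun a m ham => ?_⟩
  · have : z = t ↔ z 0 = t 0 :=
      ⟨fun h => h ▸ rfl, fun h => funext fun j => by rw [Subsingleton.elim j 0, h]⟩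
    rw [Set.mem_sdiff, h.inp, Set.mem_singleton_iff, this, List.mem_cons]
    constructor
    · tauto
    · exact fun hz => ⟨.inr hz, fun hz' => ht (hz' ▸ hz)⟩
  · exact h.first (t 0) l List.suffix_rfl _ rfl
  · exact h.next (t 0) l List.suffix_rfl _ rfl
  · exact h.first a m (ham.trans (List.suffix_cons _ _))
  · exact h.next a m (ham.trans (List.suffix_cons _ _))

/-- The heights of the stacks are the values of the counters. -/
def StackInv {k : ℕ} {D : Type} (s : RawState 1 2 (Option (Fin k)) (StackSym (Fin k)) D)
    (x : ℕ × (Fin k → ℕ)) : Prop :=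
  s.count = x.1 ∧ ∀ i, ∃ l, IsStack (s.inp (some i)) (s.aux (.empty i)) (s.aux (.first i))
    (s.aux (.top i)) (s.aux (.next i)) l ∧ l.length = x.2 i

theorem stackInv_step {k : ℕ} {D : Type} {s : RawState 1 2 (Option (Fin k)) (StackSym (Fin k)) D}
    {x : ℕ × (Fin k → ℕ)} {y : Fin 2 → D} {a : Op (Fin k)} {t : Fin 1 → D} (hs : StackInv s x)
    (ht : ((stackGadget k).guard a).Eval s.inp s.aux s.count (Sum.elim t y)) :
    ∃ x', a.Step x x' ∧ StackInv ((stackGadget k).step s ((stackGadget k).mod a t)) x' := by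
  obtain ⟨c, v⟩ := x
  obtain ⟨rfl, hv⟩ := hs
  simp only at hv
  cases a with
  | inc i =>
    have ht : t ∉ s.inp (some i) := ht
    refine ⟨_, rfl, ?_, fun j => ?_⟩
    · simp [RawProgram.step, Gadget.mod, stackGadget]
    · obtain ⟨l, hl, hlen⟩ := hv j
      rcases eq_or_ne j i with rfl | hj
      · refine ⟨t 0 :: l, ?_, by simp [hlen]⟩
        convert hl.push ht using 1
        · exact RawMod.apply_ins_self _ _ _
        all_goals
          ext z
          simp [RawProgram.step, Gadget.mod, stackGadget, pushUpdate, Sum.elim_comp_inr]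
      · refine ⟨l, ?_, by simp [Function.update_of_ne hj, hlen]⟩
        convert hl using 1
        · exact RawMod.apply_of_ne (δ := (stackGadget k).mod (.inc i) t) (x := some j) s.inp
            (by simpa [Gadget.mod, stackGadget] using hj)
        all_goals
          ext z
          simp [RawProgram.step, Gadget.mod, stackGadget, pushUpdate, hj, Sum.elim_comp_inr]
  | dec i =>
    have ht : (fun _ => t 0) ∈ s.aux (.top i) := ht
    have hne : v i ≠ 0 := by
      obtain ⟨l, hl, hlen⟩ := hv i
      rw [hl.top] at ht
      rintro h0
      rw [h0, List.length_eq_zero_iff] at hlen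
      simp [hlen] at ht
    refine ⟨_, ⟨hne, rfl⟩, ?_, fun j => ?_⟩
    · simp [RawProgram.step, Gadget.mod, stackGadget]
    · obtain ⟨l, hl, hlen⟩ := hv j
      rcases eq_or_ne j i with rfl | hj
      · obtain ⟨m, rfl⟩ : ∃ m, l = t 0 :: m := by
          rw [hl.top] at ht
          cases l with
          | nil => simp at ht
          | cons a m => exact ⟨m, by simpa using ht⟩
        refine ⟨m, ?_, by simp [← hlen]⟩
        convert hl.pop using 1
        · exact RawMod.apply_del_self _ _ _
        all_goals
          ext z
          simp [RawProgram.step, Gadget.mod, stackGadget, popUpdate, Sum.elim_comp_inr]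
        · exact Iff.rfl
        · refine iff_of_eq (congrArg (· ∈ _) (funext fun j => ?_))
          fin_cases j <;> rfl
      · refine ⟨l, ?_, by simp [Function.update_of_ne hj, hlen]⟩
        convert hl using 1
        · exact RawMod.apply_of_ne (δ := (stackGadget k).mod (.dec i) t) (x := some j) s.inp
            (by simpa [Gadget.mod, stackGadget] using hj)
        all_goals
          ext z
          simp [RawProgram.step, Gadget.mod, stackGadget, popUpdate, hj, Sum.elim_comp_inr]
  | zero i =>
    have ht : (fun _ => t 0) ∈ s.aux (.empty i) := ht
    refine ⟨_, ⟨?_, rfl⟩, ?_, fun j => ?_⟩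
    · obtain ⟨l, hl, hlen⟩ := hv i
      rw [hl.empty] at ht
      simp [← hlen, ht]
    · simp [RawProgram.step, Gadget.mod, stackGadget]
    · obtain ⟨l, hl, hlen⟩ := hv j
      refine ⟨l, ?_, hlen⟩
      convert hl using 1
      · exact RawMod.apply_of_ne (δ := (stackGadget k).mod (.zero i) t) (x := some j) s.inp
            (by simp [Gadget.mod, stackGadget])
      all_goals rfl
  | tick =>
    have ht : ¬ s.count = 0 := ht
    refine ⟨_, ⟨ht, rfl⟩, ?_, fun j => ?_⟩
    · simp [RawProgram.step, Gadget.mod, stackGadget]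
    · obtain ⟨l, hl, hlen⟩ := hv j
      refine ⟨l, ?_, hlen⟩
      convert hl using 1
      · exact RawMod.apply_of_ne (δ := (stackGadget k).mod .tick t) (x := some j) s.inp
            (by simp [Gadget.mod, stackGadget])
      all_goals rfl
  | done =>
    have ht : s.count = 0 := ht
    refine ⟨_, ⟨ht, rfl⟩, ?_, fun j => ?_⟩
    · simp [RawProgram.step, Gadget.mod, stackGadget]
    · obtain ⟨l, hl, hlen⟩ := hv j
      refine ⟨l, ?_, hlen⟩
      convert hl using 1
      · exact RawMod.apply_of_ne (δ := (stackGadget k).mod .done t) (x := some j) s.inp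
            (by simp [Gadget.mod, stackGadget])
      all_goals rfl

theorem exists_notMem_of_length_lt {D : Type} [Finite D] {l : List D}
    (h : l.length < Nat.card D) : ∃ d, d ∉ l := by
  classical
  have := Fintype.ofFinite D
  by_contra! hcon
  have h1 : l.toFinset = Finset.univ := Finset.eq_univ_of_forall fun d => by simp [hcon d]
  have h2 := l.toFinset_card_le
  rw [h1, Finset.card_univ, ← Nat.card_eq_fintype_card] at h2
  omega

/-- Simulation with stacks as counters. -/
def stackSimulation (k : ℕ) : (stackGadget k).Simulation k :=
  .ofDirect (stackGadget k) StackInv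
    (fun n => ⟨rfl, fun i => ⟨[], by constructor <;> simp [RawProgram.start, stackGadget], rfl⟩⟩)
    (fun y s x a t hs ht => stackInv_step hs ht)
    (fun {D} _ _ y s x x' a hs h hx => by
      obtain ⟨h1, h2⟩ := hs
      have d : D := Classical.arbitrary D
      cases a with
      | inc i =>
        obtain ⟨l, hl, hlen⟩ := h2 i
        obtain ⟨d, hd⟩ := exists_notMem_of_length_lt (l := l) (by have := hx i; omega)
        exact ⟨fun _ => d, fun h => hd ((hl.inp _).1 h)⟩
      | dec i =>
        obtain ⟨l, hl, hlen⟩ := h2 i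
        cases l with
        | nil => exact absurd hlen.symm h.1
        | cons a m => exact ⟨fun _ => a, (hl.top _).2 rfl⟩
      | zero i =>
        obtain ⟨l, hl, hlen⟩ := h2 i
        exact ⟨fun _ => d, (hl.empty _).2 (List.length_eq_zero_iff.1 (hlen.trans h.1))⟩
      | tick => exact ⟨fun _ => d, fun h0 => h.1 (h1.symm.trans h0)⟩
      | done => exact ⟨fun _ => d, h1.trans h.1⟩)

theorem not_emptinessDecidable_dynProp_one_two : ¬ EmptinessDecidable (DynProp 1 2) := by
  obtain ⟨k, R, hR⟩ := exists_not_computablePred_runnable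
  exact (stackGadget k).not_emptinessDecidable_dynProp
    ((stackSimulation k).image R).isRegular_matches' (qf_stackGadget k)
    ((stackSimulation k).not_computablePred_feasible hR)

end DynComplexity

namespace DynComplexity

/-! ### Counters as stacks in binary input relations -/

/-- Binary input symbols. Elements are stored as loops, apart from `next`, whose pairs lead from an
element of a stack, or the common bottom of all stacks, to the element above it. -/
inductive PairSym (ι : Type) : Type
  | nop
  | base
  | new
  | top (i : ι)
  | next (i : ι)
  | used (i : ι)
  deriving Fintype

/-- Operations on the binary input symbols. -/
inductive PairAct (ι : Type) : Type
  | zero (i : ι)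
  | tick
  | done
  | addBase
  | initTop (i : ι)
  | guess
  | guessFresh (i : ι)
  | clearNew
  | link (i : ι)
  | unlink (i : ι)
  | addTop (i : ι)
  | delTop (i : ι)
  | addUsed (i : ι)
  | delUsed (i : ι)
  deriving Fintype

/-- The tuple is a loop. -/
def isLoop {S : Type} : Raw 2 0 S Empty := .eq (.inl 0) (.inl 1)

/-- The relation contains the loop at coordinate `j` of the tuple. -/
def loopAt {S : Type} (x : S) (j : Fin 2) : Raw 2 0 S Empty := .inp x fun _ => .inl j

/-- The kind of an operation on binary input symbols. -/
def PairAct.kind {ι : Type} : PairAct ι → OpKind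
  | tick | clearNew | unlink _ | delTop _ | delUsed _ => .del
  | _ => .ins

/-- The symbol of an operation on binary input symbols. -/
def PairAct.symbol {ι : Type} : PairAct ι → PairSym ι
  | zero _ | tick | done => .nop
  | addBase => .base
  | guess | guessFresh _ | clearNew => .new
  | initTop i | addTop i | delTop i => .top i
  | link i | unlink i => .next i
  | addUsed i | delUsed i => .used i

/-- The guard of an operation on binary input symbols. -/
def PairAct.guard {ι : Type} : PairAct ι → Raw 2 0 (PairSym ι) Empty
  | zero i => .and (loopAt (.top i) 0) (loopAt .base 0)
  | tick => .not .zero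
  | done => .zero
  | addBase => isLoop
  | initTop _ => .and isLoop (loopAt .base 0)
  | guess => isLoop
  | guessFresh i => .and isLoop (.and (.not (loopAt (.used i) 0)) (.not (loopAt .base 0)))
  | clearNew => .and isLoop (loopAt .new 0)
  | link i => .and (loopAt (.top i) 0) (loopAt .new 1)
  | unlink i => .and (loopAt .new 0) (.and (loopAt (.top i) 1) (.inp (.next i) .inl))
  | addTop _ => .and isLoop (loopAt .new 0)
  | delTop i => .and isLoop (loopAt (.top i) 0)
  | addUsed _ => .and isLoop (loopAt .new 0)
  | delUsed i => .and isLoop (loopAt (.top i) 0)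

/-- Counters are stacks in binary input relations, without auxiliary relations. -/
def pairGadget (k : ℕ) : Gadget 2 0 (PairSym (Fin k)) Empty (PairAct (Fin k)) where
  tick := .nop
  update _ _ := nofun
  init := nofun
  kind := PairAct.kind
  symbol := PairAct.symbol
  guard := PairAct.guard

theorem qf_pairGadget (k : ℕ) : (pairGadget k).QF := by
  refine ⟨fun _ _ => nofun, fun a => ?_⟩
  cases a <;> simp [pairGadget, PairAct.guard, isLoop, loopAt]

/-- The operations that simulate an instruction. -/
def pairWord {k : ℕ} : Op (Fin k) → List (PairAct (Fin k))
  | .inc i => [.guessFresh i, .link i, .delTop i, .addTop i, .addUsed i, .clearNew]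
  | .dec i => [.guess, .unlink i, .delUsed i, .delTop i, .addTop i, .clearNew]
  | .zero i => [.zero i]
  | .tick => [.tick]
  | .done => [.done]

/-- The relations represent the stack `l`, whose top is its head, over the bottom `b`. -/
structure IsPairStack {D : Type} (b : D) (T N U : Set (Fin 2 → D)) (l : List D) : Prop where
  nodup : (b :: l).Nodup
  top : ∀ t, t ∈ T ↔ t 0 = l.headD b ∧ t 1 = l.headD b
  next : ∀ t, t ∈ N ↔ ∃ m, t 1 :: m <:+ l ∧ m.headD b = t 0
  used : ∀ t, t ∈ U ↔ t 0 = t 1 ∧ t 0 ∈ l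

theorem IsPairStack.push {D : Type} {b d : D} {T N U T' N' U' : Set (Fin 2 → D)} {l : List D}
    (h : IsPairStack b T N U l) (hd : d ∉ b :: l)
    (hT : ∀ t, t ∈ T' ↔ t 0 = d ∧ t 1 = d)
    (hN : ∀ t, t ∈ N' ↔ t ∈ N ∨ t 0 = l.headD b ∧ t 1 = d)
    (hU : ∀ t, t ∈ U' ↔ t ∈ U ∨ t 0 = d ∧ t 1 = d) : IsPairStack b T' N' U' (d :: l) where
  nodup := by
    have := h.nodup
    simp_all [eq_comm]
  top := hT
  next t := by
    rw [hN, h.next]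
    simp only [List.suffix_cons_iff, List.cons.injEq]
    constructor
    · rintro (⟨m, h1, h2⟩ | ⟨h1, h2⟩)
      · exact ⟨m, .inr h1, h2⟩
      · exact ⟨l, .inl ⟨h2, rfl⟩, h1.symm⟩
    · rintro ⟨m, ⟨h1, rfl⟩ | h1, h2⟩
      · exact .inr ⟨h2.symm, h1⟩
      · exact .inl ⟨m, h1, h2⟩
  used t := by
    rw [hU, h.used, List.mem_cons]
    grind

theorem IsPairStack.pop {D : Type} {b d : D} {T N U T' N' U' : Set (Fin 2 → D)} {l : List D}
    (h : IsPairStack b T N U (d :: l))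
    (hT : ∀ t, t ∈ T' ↔ t 0 = l.headD b ∧ t 1 = l.headD b)
    (hN : ∀ t, t ∈ N' ↔ t ∈ N ∧ ¬ (t 0 = l.headD b ∧ t 1 = d))
    (hU : ∀ t, t ∈ U' ↔ t ∈ U ∧ ¬ (t 0 = d ∧ t 1 = d)) : IsPairStack b T' N' U' l where
  nodup := by
    have := h.nodup
    simp_all
  top := hT
  next t := by
    have hd : d ∉ l := by have := h.nodup; simp_all
    rw [hN, h.next]
    simp only [List.suffix_cons_iff, List.cons.injEq]
    constructor
    · rintro ⟨⟨m, ⟨h1, rfl⟩ | h1, h2⟩, h3⟩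
      · exact absurd ⟨h2.symm, h1⟩ h3
      · exact ⟨m, h1, h2⟩
    · rintro ⟨m, h1, h2⟩
      exact ⟨⟨m, .inr h1, h2⟩, fun h3 => hd (h3.2 ▸ h1.subset (by simp))⟩
  used t := by
    have hd : d ∉ l := by have := h.nodup; simp_all
    rw [hU, h.used, List.mem_cons]
    grind

/-- A link into the top verifies a guessed predecessor: without repetitions, only the whole stack is
a suffix that begins with the top. No link leads into the bottom of an empty stack, so the check
also rules out popping there. -/
theorem IsPairStack.exists_of_mem_next {D : Type} {b : D} {T N U : Set (Fin 2 → D)} {l : List D}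
    (h : IsPairStack b T N U l) {t : Fin 2 → D} (ht : t ∈ N) (h1 : t 1 = l.headD b) :
    ∃ d m, l = d :: m ∧ t 1 = d ∧ t 0 = m.headD b := by
  obtain ⟨m, hm, h0⟩ := (h.next t).1 ht
  cases l with
  | nil => simp at hm
  | cons d l =>
    obtain rfl : t 1 = d := h1
    rcases List.suffix_cons_iff.1 hm with h2 | h2
    · exact ⟨_, l, rfl, rfl, by rw [← h0, (List.cons.inj h2).2]⟩
    · have := h.nodup
      exact absurd (h2.subset (by simp)) (List.nodup_cons.1 (List.nodup_cons.1 this).2).1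

/-- The heights of the stacks are the values of the counters. -/
def PairInv {k : ℕ} {D : Type} (s : RawState 2 0 (PairSym (Fin k)) Empty D)
    (x : ℕ × (Fin k → ℕ)) : Prop :=
  s.count = x.1 ∧ ∃ b, (∀ t, t ∈ s.inp .base ↔ t 0 = b ∧ t 1 = b) ∧ (∀ t, t ∉ s.inp .new) ∧
    ∀ i, ∃ l, IsPairStack b (s.inp (.top i)) (s.inp (.next i)) (s.inp (.used i)) l ∧
      l.length = x.2 i

section
variable {k : ℕ} {D : Type} {s : RawState 2 0 (PairSym (Fin k)) Empty D} {y : Fin 0 → D}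

theorem mem_pair_step {a : PairAct (Fin k)} {u t : Fin 2 → D} {x : PairSym (Fin k)} :
    t ∈ ((pairGadget k).step s ((pairGadget k).mod a u)).inp x ↔
      (a.kind = .ins ∧ x = a.symbol ∧ t 0 = u 0 ∧ t 1 = u 1) ∨
        (t ∈ s.inp x ∧ ¬ (a.kind = .del ∧ x = a.symbol ∧ t 0 = u 0 ∧ t 1 = u 1)) := by
  have : t = u ↔ t 0 = u 0 ∧ t 1 = u 1 := by rw [funext_iff, Fin.forall_fin_two]
  rw [← this]
  exact RawMod.mem_apply _ _ _ _

theorem count_pair_step {a : PairAct (Fin k)} {u : Fin 2 → D} (h : a ≠ .tick) :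
    ((pairGadget k).step s ((pairGadget k).mod a u)).count = s.count :=
  if_neg fun h' => by
    cases a <;> simp_all [pairGadget, Gadget.mod, PairAct.kind, PairAct.symbol]

theorem guard_pairGadget (a : PairAct (Fin k)) : (pairGadget k).guard a = a.guard := rfl

theorem eval_loopAt {u : Fin 2 → D} {x : PairSym (Fin k)} {j : Fin 2} :
    (loopAt x j).Eval s.inp s.aux s.count (Sum.elim u y) ↔ (fun _ => u j) ∈ s.inp x := Iff.rfl

theorem eval_isLoop {u : Fin 2 → D} :
    isLoop.Eval s.inp s.aux s.count (Sum.elim u y) ↔ u 0 = u 1 := Iff.rfl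

/-- The single loop in `new` carries the chosen fresh element from one modification to the next, as
guards see only one tuple at a time. Once cleared, it is available for the next instruction. -/
theorem pairInv_inc {x : ℕ × (Fin k → ℕ)} {i : Fin k} {α : List (RawMod 2 (PairSym (Fin k)) D)}
    (hs : PairInv s x) (hα : (pairGadget k).Match y s (pairWord (.inc i)) α) :
    PairInv ((pairGadget k).run s α) (x.1, Function.update x.2 i (x.2 i + 1)) := by
  obtain ⟨hc, b, hb, hn, hl⟩ := hs
  obtain ⟨l, hli, hlen⟩ := hl i
  simp only [pairWord, Gadget.match_cons, Gadget.match_nil] at hα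
  obtain ⟨t1, _, rfl, g1, t2, _, rfl, g2, t3, _, rfl, g3, t4, _, rfl, g4, t5, _, rfl, g5,
    t6, _, rfl, g6, rfl⟩ := hα
  -- Traced back to `s`, the guards determine all tuples but the first: `t2` leads from the old top
  -- to `t1 0`, `t3` is the loop at the old top, and `t4`, `t5`, `t6` are the loop at `t1 0`.
  simp only [guard_pairGadget, PairAct.guard, Raw.eval_and, Raw.eval_not, eval_loopAt, eval_isLoop, mem_pair_step,
    PairAct.kind, PairAct.symbol, hb, hn, hli.top, hli.used, reduceCtorEq, false_and, and_false,
    not_false_eq_true, and_true, true_and, false_or, or_false, and_self] at g1 g2 g3 g4 g5 g6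
  simp only [RawProgram.run, List.foldl_cons, List.foldl_nil]
  refine ⟨?_, b, fun t => ?_, fun t => ?_, fun j => ?_⟩
  · simpa [count_pair_step] using hc
  · simp [mem_pair_step, PairAct.kind, PairAct.symbol, hb]
  · simp only [mem_pair_step, PairAct.kind, PairAct.symbol, hn, reduceCtorEq]
    grind
  · rcases eq_or_ne j i with rfl | hj
    · refine ⟨t1 0 :: l, hli.push (by grind) (fun t => ?_) (fun t => ?_) fun t => ?_,
        by simp [hlen]⟩
      · simp only [mem_pair_step, PairAct.kind, PairAct.symbol, hli.top, reduceCtorEq]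
        grind
      · simp only [mem_pair_step, PairAct.kind, PairAct.symbol, reduceCtorEq]
        grind
      · simp only [mem_pair_step, PairAct.kind, PairAct.symbol, reduceCtorEq]
        grind
    · obtain ⟨m, hm, hlen'⟩ := hl j
      refine ⟨m, ?_, by simp [Function.update_of_ne hj, hlen']⟩
      convert hm using 1 <;> ext t <;>
        simp [mem_pair_step, PairAct.kind, PairAct.symbol, hj]

theorem pairInv_dec {x : ℕ × (Fin k → ℕ)} {i : Fin k} {α : List (RawMod 2 (PairSym (Fin k)) D)}
    (hs : PairInv s x) (hα : (pairGadget k).Match y s (pairWord (.dec i)) α) :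
    x.2 i ≠ 0 ∧ PairInv ((pairGadget k).run s α) (x.1, Function.update x.2 i (x.2 i - 1)) := by
  obtain ⟨hc, b, hb, hn, hl⟩ := hs
  obtain ⟨l, hli, hlen⟩ := hl i
  simp only [pairWord, Gadget.match_cons, Gadget.match_nil] at hα
  obtain ⟨t1, _, rfl, g1, t2, _, rfl, g2, t3, _, rfl, g3, t4, _, rfl, g4, t5, _, rfl, g5,
    t6, _, rfl, g6, rfl⟩ := hα
  simp only [guard_pairGadget, PairAct.guard, Raw.eval_and, Raw.eval_inp, eval_loopAt, eval_isLoop,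
    mem_pair_step, PairAct.kind, PairAct.symbol, hn, hli.top, reduceCtorEq, false_and, and_false,
    not_false_eq_true, and_true, true_and, false_or, or_false, and_self,
    Sum.elim_comp_inl] at g1 g2 g3 g4 g5 g6
  -- The guess in `t1` is unrestricted; the guard of `unlink` forces it to be the element below the
  -- top.
  obtain ⟨d, m, rfl, h1, h2⟩ := hli.exists_of_mem_next g2.2.2 g2.2.1
  rw [List.headD_cons] at g2 g3 g4
  refine ⟨by simp [← hlen], ?_⟩
  simp only [RawProgram.run, List.foldl_cons, List.foldl_nil]
  refine ⟨?_, b, fun t => ?_, fun t => ?_, fun j => ?_⟩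
  · simpa [count_pair_step] using hc
  · simp [mem_pair_step, PairAct.kind, PairAct.symbol, hb]
  · simp only [mem_pair_step, PairAct.kind, PairAct.symbol, hn, reduceCtorEq]
    grind
  · rcases eq_or_ne j i with rfl | hj
    · refine ⟨m, hli.pop (fun t => ?_) (fun t => ?_) fun t => ?_, by simp [← hlen]⟩
      · simp only [mem_pair_step, PairAct.kind, PairAct.symbol, hli.top, reduceCtorEq,
          List.headD_cons]
        grind
      · simp only [mem_pair_step, PairAct.kind, PairAct.symbol, reduceCtorEq]
        grind
      · simp only [mem_pair_step, PairAct.kind, PairAct.symbol, reduceCtorEq]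
        grind
    · obtain ⟨m, hm, hlen'⟩ := hl j
      refine ⟨m, ?_, by simp [Function.update_of_ne hj, hlen']⟩
      convert hm using 1 <;> ext t <;>
        simp [mem_pair_step, PairAct.kind, PairAct.symbol, hj]

theorem pairInv_nop {x : ℕ × (Fin k → ℕ)} {c : ℕ} {a : PairAct (Fin k)} {t : Fin 2 → D}
    (hs : PairInv s x) (ha : a.symbol = .nop)
    (hc : ((pairGadget k).step s ((pairGadget k).mod a t)).count = c) :
    PairInv ((pairGadget k).step s ((pairGadget k).mod a t)) (c, x.2) := by
  obtain ⟨-, b, hb, hn, hl⟩ := hs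
  have h : ∀ z ≠ .nop, ((pairGadget k).step s ((pairGadget k).mod a t)).inp z = s.inp z := by
    intro z hz
    ext u
    simp [mem_pair_step, ha, hz]
  refine ⟨hc, b, by simpa [h] using hb, by simpa [h] using hn, fun i => ?_⟩
  obtain ⟨l, hli, hlen⟩ := hl i
  exact ⟨l, by simpa [h] using hli, hlen⟩

theorem pairInv_sound {x : ℕ × (Fin k → ℕ)} {a : Op (Fin k)} {α : List (RawMod 2 (PairSym (Fin k)) D)}
    (hs : PairInv s x) (hα : (pairGadget k).Match y s (pairWord a) α) :
    ∃ x', a.Step x x' ∧ PairInv ((pairGadget k).run s α) x' := by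
  cases a with
  | inc i => exact ⟨_, rfl, pairInv_inc hs hα⟩
  | dec i => exact ⟨_, ⟨(pairInv_dec hs hα).1, rfl⟩, (pairInv_dec hs hα).2⟩
  | zero i =>
    simp only [pairWord, Gadget.match_cons, Gadget.match_nil] at hα
    obtain ⟨t, _, rfl, g, rfl⟩ := hα
    refine ⟨x, ⟨?_, rfl⟩, pairInv_nop hs rfl ?_⟩
    · obtain ⟨-, b, hb, -, hl⟩ := hs
      obtain ⟨l, hli, hlen⟩ := hl i
      simp only [guard_pairGadget, PairAct.guard, Raw.eval_and, eval_loopAt, hli.top, hb] at g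
      cases l with
      | nil => exact hlen.symm
      | cons d m =>
        have := hli.nodup
        simp only [List.headD_cons] at g
        -- The top would be the common bottom, which is never an element of a stack.
        obtain rfl : d = b := by rw [← g.1.1, g.2.1]
        simp at this
    · rw [count_pair_step (by simp)]
      exact hs.1
  | tick =>
    simp only [pairWord, Gadget.match_cons, Gadget.match_nil] at hα
    obtain ⟨t, _, rfl, g, rfl⟩ := hα
    have g : ¬ s.count = 0 := g
    refine ⟨_, ⟨hs.1 ▸ g, rfl⟩, pairInv_nop hs rfl ?_⟩
    rw [← hs.1]
    exact if_pos ⟨rfl, rfl⟩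
  | done =>
    simp only [pairWord, Gadget.match_cons, Gadget.match_nil] at hα
    obtain ⟨t, _, rfl, g, rfl⟩ := hα
    have g : s.count = 0 := g
    refine ⟨x, ⟨hs.1 ▸ g, rfl⟩, pairInv_nop hs rfl ?_⟩
    rw [count_pair_step (by simp)]
    exact hs.1

theorem exists_match_pairWord [Finite D] [Nonempty D] {x x' : ℕ × (Fin k → ℕ)} {a : Op (Fin k)}
    (hs : PairInv s x) (h : a.Step x x') (hx : ∀ i, x.2 i + 1 < Nat.card D) :
    ∃ α, (pairGadget k).Match y s (pairWord a) α := by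
  obtain ⟨hc, b, hb, hn, hl⟩ := hs
  cases a with
  | inc i =>
    obtain ⟨l, hli, hlen⟩ := hl i
    -- The bottom occupies one element of the domain, hence the strict bound on the counter plus
    -- one.
    obtain ⟨d, hd⟩ := exists_notMem_of_length_lt (l := b :: l)
      (by have := hx i; simpa [hlen] using this)
    simp only [List.mem_cons, not_or] at hd
    simp only [pairWord, Gadget.match_cons, Gadget.match_nil]
    refine ⟨_, fun _ => d, _, rfl, ?_, ![l.headD b, d], _, rfl, ?_, fun _ => l.headD b, _, rfl, ?_,
      fun _ => d, _, rfl, ?_, fun _ => d, _, rfl, ?_, fun _ => d, _, rfl, ?_, rfl⟩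
    all_goals simp [guard_pairGadget, PairAct.guard, eval_loopAt, eval_isLoop, mem_pair_step,
      PairAct.kind, PairAct.symbol, hb, hn, hli.top, hli.used, hd]
  | dec i =>
    obtain ⟨l, hli, hlen⟩ := hl i
    cases l with
    | nil => exact absurd hlen.symm h.1
    | cons d m =>
      obtain ⟨e, he⟩ : ∃ e, ![e, d] ∈ s.inp (.next i) :=
        ⟨m.headD b, (hli.next _).2 ⟨m, List.suffix_rfl, rfl⟩⟩
      simp only [pairWord, Gadget.match_cons, Gadget.match_nil]
      refine ⟨_, fun _ => e, _, rfl, ?_, ![e, d], _, rfl, ?_, fun _ => d, _, rfl,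
        ?_, fun _ => d, _, rfl, ?_, fun _ => e, _, rfl, ?_, fun _ => e, _, rfl, ?_,
        rfl⟩
      all_goals simp [guard_pairGadget, PairAct.guard, eval_loopAt, eval_isLoop, mem_pair_step,
        PairAct.kind, PairAct.symbol, hn, hli.top, he]
  | zero i =>
    obtain ⟨l, hli, hlen⟩ := hl i
    obtain rfl : l = [] := List.length_eq_zero_iff.1 (hlen.trans h.1)
    simp only [pairWord, Gadget.match_cons, Gadget.match_nil]
    refine ⟨_, fun _ => b, _, rfl, ?_, rfl⟩
    simp [guard_pairGadget, PairAct.guard, eval_loopAt, hb, hli.top]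
  | tick =>
    simp only [pairWord, Gadget.match_cons, Gadget.match_nil]
    exact ⟨_, fun _ => b, _, rfl, fun h0 => h.1 (hc.symm.trans h0), rfl⟩
  | done =>
    simp only [pairWord, Gadget.match_cons, Gadget.match_nil]
    exact ⟨_, fun _ => b, _, rfl, hc.trans h.1, rfl⟩

/-- After the choice of the common bottom `b`, it becomes the top of the stacks in `L`. -/
theorem run_initTop {b : D} {L : List (Fin k)} :
    ∀ {s : RawState 2 0 (PairSym (Fin k)) Empty D} {α : List (RawMod 2 (PairSym (Fin k)) D)},
      (∀ t, t ∈ s.inp .base ↔ t 0 = b ∧ t 1 = b) → (pairGadget k).Match y s (L.map .initTop) α →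
        ((pairGadget k).run s α).count = s.count ∧
        (∀ z t, t ∈ ((pairGadget k).run s α).inp z ↔
          t ∈ s.inp z ∨ (∃ i ∈ L, z = .top i) ∧ t 0 = b ∧ t 1 = b) := by
  induction L with
  | nil =>
    intro s α _ h
    rw [List.map_nil, Gadget.match_nil] at h
    subst h
    simp [RawProgram.run]
  | cons i L ih =>
    intro s α hb h
    rw [List.map_cons, Gadget.match_cons] at h
    obtain ⟨t, β, rfl, g, h⟩ := h
    simp only [guard_pairGadget, PairAct.guard, Raw.eval_and, eval_loopAt, eval_isLoop, hb] at g
    obtain ⟨h1, h2⟩ := ih (fun u => by simp [mem_pair_step, PairAct.kind, PairAct.symbol, hb]) h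
    refine ⟨h1.trans (count_pair_step (by simp)), fun z u => (h2 z u).trans ?_⟩
    simp only [mem_pair_step, PairAct.kind, PairAct.symbol, reduceCtorEq, List.mem_cons]
    grind

theorem exists_match_initTop {b : D} {L : List (Fin k)} :
    ∀ {s : RawState 2 0 (PairSym (Fin k)) Empty D}, (∀ t, t ∈ s.inp .base ↔ t 0 = b ∧ t 1 = b) →
      ∃ α, (pairGadget k).Match y s (L.map .initTop) α := by
  induction L with
  | nil => exact fun _ => ⟨[], trivial⟩
  | cons i L ih =>
    intro s hb
    obtain ⟨α, hα⟩ := ih (s := (pairGadget k).step s ((pairGadget k).mod (.initTop i) fun _ => b))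
      fun u => by simp [mem_pair_step, PairAct.kind, PairAct.symbol, hb]
    rw [List.map_cons]
    refine ⟨_, (Gadget.match_cons _).2 ⟨fun _ => b, α, rfl, ?_, hα⟩⟩
    simp [guard_pairGadget, PairAct.guard, eval_loopAt, eval_isLoop, hb]

end

/-- Simulation with stacks in binary input relations as counters. -/
def pairSimulation (k : ℕ) : (pairGadget k).Simulation k where
  h := pairWord
  setup := .addBase :: (List.finRange k).map .initTop
  Inv := PairInv
  inv_setup {D} _ y n α h := by
    rw [Gadget.match_cons] at h
    obtain ⟨t, β, rfl, g, h⟩ := h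
    have g : t 0 = t 1 := g
    have hstart : ∀ z u, u ∉ ((pairGadget k).start n D).inp z := fun _ _ h => h
    obtain ⟨h1, h2⟩ := run_initTop (b := t 0)
      (fun u => by simp [mem_pair_step, PairAct.kind, PairAct.symbol, hstart, ← g]) h
    change PairInv ((pairGadget k).run _ β) _
    refine ⟨h1.trans (count_pair_step (by simp)), t 0, fun u => ?_, fun u => ?_, fun i =>
      ⟨[], ⟨by simp, fun u => ?_, fun u => ?_, fun u => ?_⟩, rfl⟩⟩
    all_goals simp [h2, mem_pair_step, PairAct.kind, PairAct.symbol, hstart, ← g]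
  exists_setup {D} _ _ y n := by
    have d : D := Classical.arbitrary D
    have hstart : ∀ z u, u ∉ ((pairGadget k).start n D).inp z := fun _ _ h => h
    obtain ⟨α, hα⟩ := exists_match_initTop (y := y) (b := d) (L := List.finRange k)
      (s := (pairGadget k).step ((pairGadget k).start n D) ((pairGadget k).mod .addBase fun _ => d))
      fun u => by simp [mem_pair_step, PairAct.kind, PairAct.symbol, hstart]
    exact ⟨_, (Gadget.match_cons _).2 ⟨fun _ => d, α, rfl, rfl, hα⟩⟩
  sound _ _ _ _ _ hs hα := pairInv_sound hs hα
  complete _ _ _ _ _ hs h hx := exists_match_pairWord hs h hx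

theorem not_emptinessDecidable_dynProp_two_zero : ¬ EmptinessDecidable (DynProp 2 0) := by
  obtain ⟨k, R, hR⟩ := exists_not_computablePred_runnable
  exact (pairGadget k).not_emptinessDecidable_dynProp
    ((pairSimulation k).image R).isRegular_matches' (qf_pairGadget k)
    ((pairSimulation k).not_computablePred_feasible hR)

end DynComplexity

theorem mainTheorem1 :
    ¬ DynComplexity.EmptinessDecidable (DynComplexity.DynFO 1 0) ∧
    ¬ DynComplexity.EmptinessDecidable (DynComplexity.DynProp 1 2) ∧
    ¬ DynComplexity.EmptinessDecidable (DynComplexity.DynProp 2 0) :=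
  ⟨DynComplexity.not_emptinessDecidable_dynFO_one_zero,
    DynComplexity.not_emptinessDecidable_dynProp_one_two,
    DynComplexity.not_emptinessDecidable_dynProp_two_zero⟩
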